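/- Let $\Theta\subseteq\mathbb R^p$, let $\mathcal Y$ be a measurable space with a reference measure $\nu$, and for $j=1,\dots,m$ and $\theta\in\Theta$ let $f_j(\cdot;\theta)$ be a probability density with respect to $\nu$ (the case in which $f_j=f$ does not depend on $j$ is included). Let $Y_1,Y_2,\dots$ be i.i.d. clusters, $Y_i=(y_{i1},\dots,y_{im})\in\mathcal Y^m$, with an arbitrary dependence inside a cluster. Assume that the marginal model is correctly specified: for some $\theta_0\in\Theta$ and every $j$, $y_{ij}$ has density $f_j(\cdot;\theta_0)$. Put $$cl_m(\theta;Y_i)=\sum_{j=1}^m\log f_j(y_{ij};\theta),\qquad cl(\theta)=\sum_{i=1}^n cl_m(\theta;Y_i),$$ $$H(\theta)=E\big[-\nabla^2 cl_m(\theta;Y_1)\big],\qquad J(\theta)=\operatorname{var}\big(\nabla cl_m(\theta;Y_1)\big),\qquad G(\theta)=H(\theta)J(\theta)^{-1}H(\theta).$$ Assume the following. (A1) If $\theta_1\ne\theta_2$ in $\Theta$, then $P(f_j(y_{1j};\theta_1)\neq f_j(y_{1j};\theta_2))>0$ for every $j$. (A2) For every $j$ the set $\{y: f_j(y;\theta)>0\}$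 is the same for all $\theta\in\Theta$. (A3) $\theta_0$ is an interior point of $\Theta$. (A4) There are $c>0$ with $\{\theta:\|\theta-\theta_0\|_2\le c\}\subseteq\Theta$ and functions $M_j$ with $E|M_j(y_{1j})|<\infty$ such that, for every $j$ and almost every value $y$ of $y_{1j}$, $\theta\mapsto\log f_j(y;\theta)$ is three times continuously differentiable on $\{\|\theta-\theta_0\|_2\le c\}$, and all its third-order partial derivatives are bounded in absolute value by $M_j(y)$ for $\|\theta-\theta_0\|_2<c$. (A5) $J(\theta_0)$ exists and is finite (the components of $\nabla cl_m(\theta_0;Y_1)$ are square integrable) and is invertible. (A6) $H(\theta_0)$ exists and is finite (the entries of $\nabla^2cl_m(\theta_0;Y_1)$ are integrable) and is positive definite. Then there are estimators $\widehat\theta^c_n=\widehat\theta^c_n(Y_1,\dots,Y_n)\in\Theta$, measurable functions of the sample, such that, with probability tending to $1$ as $n\to\infty$, $\widehat\theta^c_n$ solves the composite likelihood equation $\nabla cl(\theta)=0$, and $$\sqrt n\,(\widehat\theta^c_n-\theta_0)\Rightarrow G^{-1/2}(\theta_0)\,Z,$$ where $Z$ is a standard normal random vector in $\mathbb R^p$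 and $G^{-1/2}(\theta_0)$ is the positive semidefinite square root of $G(\theta_0)^{-1}$. -/

import Mathlib

open MeasureTheory ProbabilityTheory Filter Topology
open scoped MatrixOrder

namespace CompositeLikelihood

noncomputable section

/-- The mixed second partial derivative `∂_a ∂_b g` at `θ`. -/
def partial2 {p : ℕ} (a b : Fin p) (g : EuclideanSpace ℝ (Fin p) → ℝ)
    (θ : EuclideanSpace ℝ (Fin p)) : ℝ :=
  iteratedFDeriv ℝ 2 g θ ![EuclideanSpace.single a 1, EuclideanSpace.single b 1]

/-- The mixed third partial derivative `∂_a ∂_b ∂_c g` at `θ`. -/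
def partial3 {p : ℕ} (a b c : Fin p) (g : EuclideanSpace ℝ (Fin p) → ℝ)
    (θ : EuclideanSpace ℝ (Fin p)) : ℝ :=
  iteratedFDeriv ℝ 3 g θ
    ![EuclideanSpace.single a 1, EuclideanSpace.single b 1, EuclideanSpace.single c 1]

/-- The univariate composite log-likelihood of one cluster `y = (y_1, …, y_m)`:
`cl_m(θ; y) = ∑_j log f_j(y_j; θ)`, where `f_j(·; θ)` is the marginal density of the `j`-th
component. -/
def clusterLogLik {m p : ℕ} {𝓨 : Type*} (f : Fin m → 𝓨 → EuclideanSpace ℝ (Fin p) → ℝ)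
    (y : Fin m → 𝓨) (θ : EuclideanSpace ℝ (Fin p)) : ℝ :=
  ∑ j, Real.log (f j (y j) θ)

/-- The univariate composite log-likelihood of `n` clusters:
`cl(θ) = ∑_i ∑_j log f_j(y_{ij}; θ)`. -/
def compositeLogLik {n m p : ℕ} {𝓨 : Type*} (f : Fin m → 𝓨 → EuclideanSpace ℝ (Fin p) → ℝ)
    (y : Fin n → Fin m → 𝓨) (θ : EuclideanSpace ℝ (Fin p)) : ℝ :=
  ∑ i, clusterLogLik f (y i) θ

/-- The composite likelihood equation `∇ cl(θ) = 0` at a point `θ` where the composite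
log-likelihood is differentiable (which is part of the condition). -/
def SolvesCompositeScore {n m p : ℕ} {𝓨 : Type*}
    (f : Fin m → 𝓨 → EuclideanSpace ℝ (Fin p) → ℝ)
    (y : Fin n → Fin m → 𝓨) (θ : EuclideanSpace ℝ (Fin p)) : Prop :=
  HasGradientAt (compositeLogLik f y) 0 θ

/-- The composite score (gradient of the composite log-likelihood) of one cluster. -/
def clusterScore {m p : ℕ} {𝓨 : Type*} (f : Fin m → 𝓨 → EuclideanSpace ℝ (Fin p) → ℝ)
    (y : Fin m → 𝓨) (θ : EuclideanSpace ℝ (Fin p)) : EuclideanSpace ℝ (Fin p) :=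
  gradient (clusterLogLik f y) θ

/-- The sensitivity matrix `H(θ) = E[-cl_m⁽²⁾(θ; y)]`, for clusters with law `Q`. For i.i.d.
clusters it equals `E[-cl⁽²⁾(θ; Y)] / n` for every `n ≥ 1`. -/
def sensitivityMatrix {m p : ℕ} {𝓨 : Type*} [MeasurableSpace 𝓨]
    (f : Fin m → 𝓨 → EuclideanSpace ℝ (Fin p) → ℝ) (Q : Measure (Fin m → 𝓨))
    (θ : EuclideanSpace ℝ (Fin p)) : Matrix (Fin p) (Fin p) ℝ :=
  Matrix.of fun a b => ∫ y, -partial2 a b (clusterLogLik f y) θ ∂Q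

/-- The variability matrix `J(θ) = var(cl_m⁽¹⁾(θ; y))`, for clusters with law `Q`. For i.i.d.
clusters it equals `var(cl⁽¹⁾(θ; Y)) / n` for every `n ≥ 1`. -/
def variabilityMatrix {m p : ℕ} {𝓨 : Type*} [MeasurableSpace 𝓨]
    (f : Fin m → 𝓨 → EuclideanSpace ℝ (Fin p) → ℝ) (Q : Measure (Fin m → 𝓨))
    (θ : EuclideanSpace ℝ (Fin p)) : Matrix (Fin p) (Fin p) ℝ :=
  Matrix.of fun a b => cov[fun y => clusterScore f y θ a, fun y => clusterScore f y θ b; Q]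

/-- The Godambe information `G(θ) = H(θ) J(θ)⁻¹ H(θ)`. -/
def godambe {m p : ℕ} {𝓨 : Type*} [MeasurableSpace 𝓨]
    (f : Fin m → 𝓨 → EuclideanSpace ℝ (Fin p) → ℝ) (Q : Measure (Fin m → 𝓨))
    (θ : EuclideanSpace ℝ (Fin p)) : Matrix (Fin p) (Fin p) ℝ :=
  sensitivityMatrix f Q θ * (variabilityMatrix f Q θ)⁻¹ * sensitivityMatrix f Q θ

/-- For every parameter `θ ∈ Θ` and every component `j`, `f_j(·; θ)` is a probability density
with respect to `ν`, and the model is correctly specified with true value `θ₀ ∈ Θ`: the `j`-th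
marginal of the cluster law `Q` has density `f_j(·; θ₀)`. The dependence between the components
of a cluster is arbitrary. -/
structure CorrectlySpecified {m p : ℕ} {𝓨 : Type*} [MeasurableSpace 𝓨] (ν : Measure 𝓨)
    (Θ : Set (EuclideanSpace ℝ (Fin p))) (f : Fin m → 𝓨 → EuclideanSpace ℝ (Fin p) → ℝ)
    (Q : Measure (Fin m → 𝓨)) (θ₀ : EuclideanSpace ℝ (Fin p)) : Prop where
  measurable : ∀ j, ∀ θ ∈ Θ, Measurable fun y => f j y θ
  nonneg : ∀ j, ∀ θ ∈ Θ, ∀ y, 0 ≤ f j y θ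
  lintegral_eq_one : ∀ j, ∀ θ ∈ Θ, ∫⁻ y, ENNReal.ofReal (f j y θ) ∂ν = 1
  true_mem : θ₀ ∈ Θ
  marginal_eq : ∀ j, Q.map (fun y => y j) = ν.withDensity fun y => ENNReal.ofReal (f j y θ₀)

/-- The regularity conditions for the marginal densities `f_j(·; θ)`, `θ ∈ Θ`, the
cluster law `Q` and the true value `θ₀`. -/
structure Regular {m p : ℕ} {𝓨 : Type*} [MeasurableSpace 𝓨]
    (Θ : Set (EuclideanSpace ℝ (Fin p))) (f : Fin m → 𝓨 → EuclideanSpace ℝ (Fin p) → ℝ)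
    (Q : Measure (Fin m → 𝓨)) (θ₀ : EuclideanSpace ℝ (Fin p)) : Prop where
  /-- Distinct parameters have distinct marginal densities. -/
  identifiable : ∀ j, ∀ θ₁ ∈ Θ, ∀ θ₂ ∈ Θ, θ₁ ≠ θ₂ → 0 < Q {y | f j (y j) θ₁ ≠ f j (y j) θ₂}
  /-- The marginal densities have a common support. -/
  common_support : ∀ j, ∀ θ₁ ∈ Θ, ∀ θ₂ ∈ Θ, {y | 0 < f j y θ₁} = {y | 0 < f j y θ₂}
  /-- The true value is an interior point of the parameter space. -/
  interior : θ₀ ∈ interior Θ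
  /-- `log f` is three times continuously differentiable in a ball around `θ₀`, where all
  third-order partial derivatives are dominated by an integrable function of `y`. -/
  domination : ∃ (c : ℝ) (M : Fin m → 𝓨 → ℝ), 0 < c ∧ Metric.closedBall θ₀ c ⊆ Θ ∧
    (∀ j, Integrable (M j) (Q.map fun y => y j)) ∧
    ∀ j, ∀ᵐ y ∂(Q.map fun y => y j),
      ContDiffOn ℝ 3 (fun θ => Real.log (f j y θ)) (Metric.closedBall θ₀ c) ∧
      ∀ θ ∈ Metric.ball θ₀ c, ∀ a b d : Fin p,
        |partial3 a b d (fun θ => Real.log (f j y θ)) θ| ≤ M j y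
  /-- `J(θ₀)` exists and is finite ... -/
  variability_finite : ∀ a, MemLp (fun y => clusterScore f y θ₀ a) 2 Q
  /-- ... and is invertible. -/
  variability_invertible : IsUnit (variabilityMatrix f Q θ₀)
  /-- `H(θ₀)` exists and is finite ... -/
  sensitivity_finite : ∀ a b, Integrable (fun y => partial2 a b (clusterLogLik f y) θ₀) Q
  /-- ... and is positive definite. -/
  sensitivity_posDef : (sensitivityMatrix f Q θ₀).PosDef

end

end CompositeLikelihood

open CompositeLikelihood

/-! The cluster is the sampling unit, so dependence inside it enters only through the covariance `J`
of the cluster score. At `θ₀` this score has mean zero. This is proved without differentiating under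
the integral: each marginal satisfies `log x ≤ x - 1` for its density ratio, whose mean is at most
1, so `cl_m(θ) - cl_m(θ₀)` is dominated by a variable of nonpositive mean. A Taylor expansion with
integrable quadratic remainder then forces the mean score to vanish
(`integral_clusterScore_eq_zero`).

The root is the fixed point of the modified Newton map `θ + H⁻¹ (n⁻¹ ∑ score)`. The averaged Hessian
tends to `-H` and the third derivatives have an integrable bound, so with probability tending to one
this map is a 1/2-contraction of a fixed small ball. Its iterates are measurable in the sample,
hence so is their limit, and no separate consistency argument is needed. The contraction estimate on
the ball of radius `‖θhat - θ₀‖` shows that `θhat - θ₀` equals `H⁻¹` times the average score at `θ₀`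
up to a relatively negligible error (`exists_root_tendstoInDistribution`).

The central limit theorem gives this linear term the Gaussian limit of covariance `H⁻¹ J H⁻¹ = G⁻¹`,
which is the law of `G^{-1/2} Z` (`Regular.charFun_limit`). -/

/-! ### Measurable fixed points -/

section FixedPoint

variable {X E : Type*} [MeasurableSpace X] [NormedAddCommGroup E]
  [CompleteSpace E] [SecondCountableTopology E] [MeasurableSpace E] [BorelSpace E]

/-- A measurable selection of the fixed points of those maps of a Carathéodory family that
contract a given closed ball. -/
theorem exists_measurable_fixedPoint (θ₀ : E) {r : ℝ} (hr : 0 ≤ r) (T : X → E → E)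
    (hTm : ∀ θ, Measurable fun x => T x θ) (hTc : ∀ x, Continuous (T x)) :
    ∃ t : X → E, Measurable t ∧ (∀ x, t x ∈ Metric.closedBall θ₀ r) ∧
      ∀ x, (∀ θ ∈ Metric.closedBall θ₀ r, ∀ θ' ∈ Metric.closedBall θ₀ r,
          ‖T x θ - T x θ'‖ ≤ 2⁻¹ * ‖θ - θ'‖) →
        ‖T x θ₀ - θ₀‖ ≤ r / 2 → T x (t x) = t x := by
  classical
  set u : ℕ → X → E := fun k x => (T x)^[k] θ₀ with hu
  have hum : ∀ k, Measurable (u k) := by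
    intro k
    induction k with
    | zero => exact measurable_const
    | succ k ih =>
      have h := measurable_uncurry_of_continuous_of_measurable (u := fun θ x => T x θ) hTc hTm
      have h2 := h.comp (ih.prodMk measurable_id)
      convert h2 using 1
      funext x
      simp only [hu, Function.iterate_succ_apply', Function.comp, Function.uncurry, id]
  have hC : MeasurableSet {x | ∃ l, Tendsto (fun k => u k x) atTop (𝓝 l)} :=
    measurableSet_exists_tendsto hum
  set C := {x | ∃ l, Tendsto (fun k => u k x) atTop (𝓝 l)} with hCdef
  set w : X → E := fun x => if h : x ∈ C then h.choose else 0 with hw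
  have hwm : Measurable w := by
    -- Cut off by the indicator of `C`, the iterates converge everywhere, to 0 off `C`; this matches
    -- the default value of `w`.
    refine measurable_of_tendsto_metrizable (f := fun k => C.indicator (u k))
      (fun k => (hum k).indicator hC) ?_
    rw [tendsto_pi_nhds]
    intro x
    by_cases hx : x ∈ C
    · simp only [hw, hx, dif_pos, Set.indicator_of_mem]
      exact (show ∃ l, Tendsto (fun k => u k x) atTop (𝓝 l) from hx).choose_spec
    · simp [hw, hx]
  have hwlim : ∀ x l, Tendsto (fun k => u k x) atTop (𝓝 l) → w x = l := by
    intro x l hl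
    have hx : x ∈ C := ⟨l, hl⟩
    simp only [hw, hx, dif_pos]
    exact tendsto_nhds_unique
      (show ∃ l, Tendsto (fun k => u k x) atTop (𝓝 l) from hx).choose_spec hl
  -- Falling back on `θ₀` keeps the selection in the ball even where the iteration fails.
  refine ⟨fun x => if w x ∈ Metric.closedBall θ₀ r then w x else θ₀, ?_, ?_, ?_⟩
  · exact Measurable.ite (hwm Metric.isClosed_closedBall.measurableSet) hwm measurable_const
  · intro x
    dsimp only
    split_ifs with h
    · exact h
    · exact Metric.mem_closedBall_self hr
  · intro x hlip hself
    have hmaps : Set.MapsTo (T x) (Metric.closedBall θ₀ r) (Metric.closedBall θ₀ r) := by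
      intro θ hθ
      have h1 := hlip θ hθ θ₀ (Metric.mem_closedBall_self hr)
      rw [mem_closedBall_iff_norm] at hθ ⊢
      have h2 : T x θ - θ₀ = (T x θ - T x θ₀) + (T x θ₀ - θ₀) := by abel
      rw [h2]
      have h3 := norm_add_le (T x θ - T x θ₀) (T x θ₀ - θ₀)
      linarith
    have hcontr : ContractingWith 2⁻¹ (hmaps.restrict (T x) _ _) := by
      refine ⟨by rw [← NNReal.coe_lt_coe]; norm_num, ?_⟩
      refine LipschitzWith.of_dist_le_mul fun a b => ?_
      rw [Subtype.dist_eq, Subtype.dist_eq, dist_eq_norm, dist_eq_norm]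
      simpa using hlip a a.2 b b.2
    obtain ⟨y, hy, hfix, hlim, -⟩ := hcontr.exists_fixedPoint'
      Metric.isClosed_closedBall.isComplete hmaps (Metric.mem_closedBall_self hr) (edist_ne_top _ _)
    have hwy : w x = y := hwlim x y hlim
    simp only [hwy, hy, if_true]
    exact hfix

end FixedPoint

/-! ### Convergence in probability -/

section InProbability

variable {Ω : Type*} [MeasurableSpace Ω] {P : Measure Ω}

/-- If `V n → v` in probability, then `V n` lies in a given neighbourhood of `v` with probability
tending to one. -/
theorem TendstoInMeasure.tendsto_measure_notMem {F : Type*} [PseudoEMetricSpace F] {V : ℕ → Ω → F}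
    {v : F} (hV : TendstoInMeasure P V atTop fun _ => v) {U : Set F} (hU : U ∈ 𝓝 v) :
    Tendsto (fun n => P {ω | V n ω ∉ U}) atTop (𝓝 0) := by
  obtain ⟨ε, hε, hεU⟩ := EMetric.mem_nhds_iff.1 hU
  refine tendsto_of_tendsto_of_tendsto_of_le_of_le tendsto_const_nhds (hV ε hε)
    (fun _ => zero_le) fun n => measure_mono fun ω hω => ?_
  by_contra h
  exact hω (hεU (by simpa using h))

/-- Convergence in distribution to zero implies convergence in probability. -/
theorem TendstoInDistribution.tendsto_measure_le_zero [IsProbabilityMeasure P] {Ω' : Type*}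
    [MeasurableSpace Ω'] {P' : Measure Ω'} [IsProbabilityMeasure P'] {X : ℕ → Ω → ℝ}
    (h : TendstoInDistribution X atTop (fun _ : Ω' => (0 : ℝ)) (fun _ => P) P') {ε : ℝ}
    (hε : 0 < ε) : Tendsto (fun n => P {ω | ε ≤ X n ω}) atTop (𝓝 0) := by
  -- Portmanteau applies to `[ε, ∞)`: its frontier `{ε}` has no mass under the point mass at 0.
  have hfr : (P'.map fun _ : Ω' => (0 : ℝ)) (frontier (Set.Ici ε)) = 0 := by
    rw [Measure.map_const, frontier_Ici]
    simp [hε.ne]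
  have := ProbabilityMeasure.tendsto_measure_of_null_frontier_of_tendsto' h.tendsto hfr
  have h2 : (P'.map fun _ : Ω' => (0 : ℝ)) (Set.Ici ε) = 0 := by
    rw [Measure.map_const]
    simp [hε]
  simp only [ProbabilityMeasure.coe_mk, h2] at this
  refine this.congr fun n => ?_
  rw [Measure.map_apply_of_aemeasurable (h.forall_aemeasurable n) measurableSet_Ici]
  rfl

end InProbability

/-! ### Asymptotically linear roots of estimating equations -/

section EstimatingEquation

variable {S E : Type*} [NormedAddCommGroup E] [NormedSpace ℝ E]

/-- One step `θ + B (n⁻¹ ∑ ψ(y_i, θ))` of the modified Newton iteration for `∑ ψ(y_i, θ) = 0`. -/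
noncomputable def newtonStep (ψ : S → E → E) (B : E →L[ℝ] E) {n : ℕ} (y : Fin n → S) (θ : E) : E :=
  θ + B ((n : ℝ)⁻¹ • ∑ i, ψ (y i) θ)

/-- Since `B A₀ = -1`, the term `θ - θ'` cancels. What remains is `B` applied to the averaged Taylor
remainders plus the deviation of the averaged derivative from `A₀`. -/
theorem norm_newtonStep_sub_le {ψ : S → E → E} {A : S → E →L[ℝ] E} {L : S → ℝ} {θ₀ : E}
    {A₀ B : E →L[ℝ] E} (hB : ∀ v, B (A₀ v) = -v) {n : ℕ} {y : Fin n → S} {ρ : ℝ}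
    (hψ : ∀ i, ∀ θ ∈ Metric.closedBall θ₀ ρ, ∀ θ' ∈ Metric.closedBall θ₀ ρ,
      ‖ψ (y i) θ - ψ (y i) θ' - A (y i) (θ - θ')‖ ≤ L (y i) * ρ * ‖θ - θ'‖)
    {θ θ' : E} (hθ : θ ∈ Metric.closedBall θ₀ ρ) (hθ' : θ' ∈ Metric.closedBall θ₀ ρ) :
    ‖newtonStep ψ B y θ - newtonStep ψ B y θ'‖ ≤
      ‖B‖ * (‖(n : ℝ)⁻¹ • ∑ i, A (y i) - A₀‖ + ((n : ℝ)⁻¹ • ∑ i, L (y i)) * ρ) * ‖θ - θ'‖ := by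
  have key : newtonStep ψ B y θ - newtonStep ψ B y θ' =
      B ((n : ℝ)⁻¹ • ∑ i, (ψ (y i) θ - ψ (y i) θ' - A (y i) (θ - θ')) +
        ((n : ℝ)⁻¹ • ∑ i, A (y i) - A₀) (θ - θ')) := by
    simp only [newtonStep, Finset.sum_sub_distrib, smul_sub, map_add, map_sub, hB,
      sub_apply, smul_apply, sum_apply]
    abel
  rw [key, mul_assoc]
  refine (B.le_opNorm _).trans (mul_le_mul_of_nonneg_left ?_ (norm_nonneg _))
  refine (norm_add_le _ _).trans ?_
  rw [add_mul, add_comm]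
  refine add_le_add (ContinuousLinearMap.le_opNorm _ _) ?_
  rw [norm_smul, smul_eq_mul, norm_inv, RCLike.norm_natCast, mul_assoc, mul_assoc]
  refine mul_le_mul_of_nonneg_left ?_ (by positivity)
  rw [Finset.sum_mul]
  refine (norm_sum_le _ _).trans (Finset.sum_le_sum fun i _ => ?_)
  simpa [mul_assoc] using hψ i θ hθ θ' hθ'

variable [MeasurableSpace S] [FiniteDimensional ℝ E] [MeasurableSpace E] [BorelSpace E]

/-- Consistent roots of an estimating equation: if the estimating function `ψ(y, ·)` has
derivative `A(y)` at `θ₀` with a Lipschitz-type remainder, the equation has a measurable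
approximate root which is asymptotically equivalent to its linearization at `θ₀`. -/
theorem exists_root_tendstoInDistribution {Q : Measure S} {ψ : S → E → E} {A : S → E →L[ℝ] E}
    {L : S → ℝ} {θ₀ : E} {c : ℝ} (hc : 0 < c) (hψm : ∀ θ, Measurable fun y => ψ y θ)
    (hψc : ∀ y, Continuous (ψ y)) (hψint : Integrable (fun y => ψ y θ₀) Q)
    (hψ0 : ∫ y, ψ y θ₀ ∂Q = 0) (hA : Integrable A Q) (hL : Integrable L Q)
    (hψ : ∀ᵐ y ∂Q, ∀ ρ ≤ c, ∀ θ ∈ Metric.closedBall θ₀ ρ, ∀ θ' ∈ Metric.closedBall θ₀ ρ,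
      ‖ψ y θ - ψ y θ' - A y (θ - θ')‖ ≤ L y * ρ * ‖θ - θ'‖)
    {B : E →L[ℝ] E} (hBinj : Function.Injective B) (hB : ∀ v, B ((∫ y, A y ∂Q) v) = -v)
    {Ω : Type*} [MeasurableSpace Ω] {P : Measure Ω} [IsProbabilityMeasure P] {Y : ℕ → Ω → S}
    (hlaw : ∀ i, HasLaw (Y i) Q P) (hindep : iIndepFun Y P)
    {Ω' : Type*} [MeasurableSpace Ω'] {P' : Measure Ω'} [IsProbabilityMeasure P'] {W : Ω' → E}
    (hW : TendstoInDistribution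
      (fun (n : ℕ) ω => √(n : ℝ) • B ((n : ℝ)⁻¹ • ∑ i ∈ Finset.range n, ψ (Y i ω) θ₀)) atTop W
      (fun _ => P) P') :
    ∃ t : (n : ℕ) → (Fin n → S) → E, (∀ n, Measurable (t n)) ∧
      (∀ n y, t n y ∈ Metric.closedBall θ₀ c) ∧
      Tendsto (fun n : ℕ => P {ω | ¬ ∑ i : Fin n, ψ (Y i ω) (t n fun i => Y i ω) = 0}) atTop
        (𝓝 0) ∧
      TendstoInDistribution (fun (n : ℕ) ω => √(n : ℝ) • (t n (fun i => Y i ω) - θ₀)) atTop W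
        (fun _ => P) P' := by
  have : ProperSpace E := FiniteDimensional.proper ℝ E
  have : ProperSpace (E →L[ℝ] E) := FiniteDimensional.proper ℝ _
  set A₀ := ∫ y, A y ∂Q with hA₀
  set l := ∫ y, L y ∂Q with hl
  -- the average of score, derivative and Lipschitz constant
  let v₀ : E × (E →L[ℝ] E) × ℝ := (0, A₀, l)
  let V : S → E × (E →L[ℝ] E) × ℝ := fun y => (ψ y θ₀, A y, L y)
  have hVint : Integrable V Q := hψint.prodMk (hA.prodMk hL)
  have hVmean : ∫ y, V y ∂Q = v₀ := by
    rw [integral_pair hψint (hA.prodMk hL), integral_pair hA hL, hψ0]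
  let Vn : ℕ → Ω → E × (E →L[ℝ] E) × ℝ := fun n ω =>
    (n : ℝ)⁻¹ • ∑ i ∈ Finset.range n, V (Y i ω)
  have hYm : ∀ i, AEMeasurable (Y i) P := fun i => (hlaw i).aemeasurable
  have hVm : ∀ i, AEMeasurable V (P.map (Y i)) := fun i => by
    rw [(hlaw i).map_eq]; exact hVint.aemeasurable
  have hident : ∀ i, IdentDistrib (fun ω => V (Y i ω)) (fun ω => V (Y 0 ω)) P P := fun i =>
    (IdentDistrib.mk (hYm i) (hYm 0) ((hlaw i).map_eq.trans (hlaw 0).map_eq.symm)).comp_of_aemeasurable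
      (hVm i)
  have hVY0 : Integrable (fun ω => V (Y 0 ω)) P := by
    have : Integrable V (P.map (Y 0)) := by rw [(hlaw 0).map_eq]; exact hVint
    exact this.comp_aemeasurable (hYm 0)
  have hVnm : ∀ n, AEStronglyMeasurable (Vn n) P := fun n =>
    (Finset.aestronglyMeasurable_fun_sum _ fun i _ =>
      (hident i).aemeasurable_fst.aestronglyMeasurable).fun_const_smul _
  -- One strong law on the product space handles all three averages jointly.
  have hslln : ∀ᵐ ω ∂P, Tendsto (fun n => Vn n ω) atTop (𝓝 v₀) := by
    have h := strong_law_ae (fun i ω => V (Y i ω)) hVY0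
      (fun i j hij => (hindep.comp₀ (fun _ => V) hYm hVm).indepFun hij) hident
    have h2 : ∫ ω, V (Y 0 ω) ∂P = v₀ := by
      rw [← hVmean]
      exact (hlaw 0).integral_comp hVint.aestronglyMeasurable
    rwa [h2] at h
  have hVn : TendstoInMeasure P Vn atTop fun _ => v₀ := tendstoInMeasure_of_tendsto_ae hVnm hslln
  -- the radius of contraction
  obtain ⟨r, hr0, hrc, hr⟩ : ∃ r, 0 < r ∧ r ≤ c ∧ ‖B‖ * (l * r) < 4⁻¹ := by
    have h1 : Tendsto (fun r : ℝ => ‖B‖ * (l * r)) (𝓝[>] 0) (𝓝 0) := by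
      have : Tendsto (fun r : ℝ => ‖B‖ * (l * r)) (𝓝 0) (𝓝 (‖B‖ * (l * 0))) :=
        Continuous.tendsto (by fun_prop) 0
      simpa using this.mono_left nhdsWithin_le_nhds
    have h2 := (h1.eventually_lt_const (show (0 : ℝ) < 4⁻¹ by norm_num)).and
      (Ioc_mem_nhdsGT hc)
    obtain ⟨r, h3, h4⟩ := h2.exists
    exact ⟨r, h4.1, h4.2, h3⟩
  -- The two bounds 1/4 add up to the contraction constant 1/2; the third bounds the first Newton
  -- step by half the radius.
  let U : Set (E × (E →L[ℝ] E) × ℝ) :=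
    {v | ‖B‖ * ‖v.2.1 - A₀‖ < 4⁻¹ ∧ ‖B‖ * (v.2.2 * r) < 4⁻¹ ∧ ‖B v.1‖ < r / 2}
  have hU : U ∈ 𝓝 v₀ := by
    refine IsOpen.mem_nhds ?_ ?_
    · have h1 : IsOpen {v : E × (E →L[ℝ] E) × ℝ | ‖B‖ * ‖v.2.1 - A₀‖ < 4⁻¹} :=
        isOpen_lt (by fun_prop) (by fun_prop)
      have h2 : IsOpen {v : E × (E →L[ℝ] E) × ℝ | ‖B‖ * (v.2.2 * r) < 4⁻¹} :=
        isOpen_lt (by fun_prop) (by fun_prop)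
      have h3 : IsOpen {v : E × (E →L[ℝ] E) × ℝ | ‖B v.1‖ < r / 2} :=
        isOpen_lt (by fun_prop) (by fun_prop)
      exact h1.inter (h2.inter h3)
    · refine ⟨by simp [v₀], by simpa [v₀] using hr, by simpa [v₀] using hr0⟩
  obtain ⟨t, htm, htmem, htfix⟩ : ∃ t : (n : ℕ) → (Fin n → S) → E, (∀ n, Measurable (t n)) ∧
      (∀ n y, t n y ∈ Metric.closedBall θ₀ r) ∧ ∀ n y,
      (∀ θ ∈ Metric.closedBall θ₀ r, ∀ θ' ∈ Metric.closedBall θ₀ r,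
          ‖newtonStep ψ B y θ - newtonStep ψ B y θ'‖ ≤ 2⁻¹ * ‖θ - θ'‖) →
        ‖newtonStep ψ B y θ₀ - θ₀‖ ≤ r / 2 → newtonStep ψ B y (t n y) = t n y := by
    have h : ∀ n : ℕ, _ := fun n => exists_measurable_fixedPoint (X := Fin n → S) θ₀ hr0.le
      (newtonStep ψ B)
      (fun θ => by
        unfold newtonStep
        exact measurable_const.add (B.measurable.comp ((Finset.measurable_fun_sum _
          fun i _ => (hψm θ).comp (measurable_pi_apply i)).const_smul _)))
      (fun y => by
        unfold newtonStep
        have := fun i => hψc (y i)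
        fun_prop)
    choose t h1 h2 h3 using h
    exact ⟨t, h1, h2, h3⟩
  -- the exceptional null set
  have hgood : ∀ᵐ ω ∂P, ∀ i, ∀ ρ ≤ c, ∀ θ ∈ Metric.closedBall θ₀ ρ,
      ∀ θ' ∈ Metric.closedBall θ₀ ρ,
      ‖ψ (Y i ω) θ - ψ (Y i ω) θ' - A (Y i ω) (θ - θ')‖ ≤ L (Y i ω) * ρ * ‖θ - θ'‖ := by
    refine ae_all_iff.2 fun i => ?_
    exact ae_of_ae_map (hYm i) (by rw [(hlaw i).map_eq]; exact hψ)
  -- This is the relative linearization error, obtained from the Lipschitz bound and `‖τ - θ₀‖ ≤ 2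
  -- ‖B v.1‖`. It is continuous and vanishes at `v₀`.
  let κ : E × (E →L[ℝ] E) × ℝ → ℝ := fun v =>
    2 * (‖B‖ * (‖v.2.1 - A₀‖ + |v.2.2| * (2 * ‖B v.1‖)))
  have hκ : Continuous κ := by fun_prop
  have main : ∀ᵐ ω ∂P, ∀ n, Vn n ω ∈ U →
      newtonStep ψ B (fun i : Fin n => Y i ω) (t n fun i => Y i ω) = (t n fun i => Y i ω) ∧
      ‖t n (fun i => Y i ω) - θ₀ - B (Vn n ω).1‖ ≤ κ (Vn n ω) * ‖B (Vn n ω).1‖ := by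
    filter_upwards [hgood] with ω hω n hn
    have e1 : (Vn n ω).1 = (n : ℝ)⁻¹ • ∑ i : Fin n, ψ (Y i ω) θ₀ := by
      rw [Fin.sum_univ_eq_sum_range (fun i => ψ (Y i ω) θ₀)]
      simp [Vn, V, Prod.fst_sum]
    have e2 : (Vn n ω).2.1 = (n : ℝ)⁻¹ • ∑ i : Fin n, A (Y i ω) := by
      rw [Fin.sum_univ_eq_sum_range (fun i => A (Y i ω))]
      simp [Vn, V, Prod.fst_sum, Prod.snd_sum]
    have e3 : (Vn n ω).2.2 = (n : ℝ)⁻¹ • ∑ i : Fin n, L (Y i ω) := by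
      rw [Fin.sum_univ_eq_sum_range (fun i => L (Y i ω))]
      simp [Vn, V, Prod.snd_sum]
    have e0 : newtonStep ψ B (fun i : Fin n => Y i ω) θ₀ - θ₀ = B (Vn n ω).1 := by
      rw [e1, newtonStep, add_sub_cancel_left]
    have hlip : ∀ ρ ≤ c, ∀ θ ∈ Metric.closedBall θ₀ ρ, ∀ θ' ∈ Metric.closedBall θ₀ ρ,
        ‖newtonStep ψ B (fun i : Fin n => Y i ω) θ - newtonStep ψ B (fun i : Fin n => Y i ω) θ'‖ ≤
        ‖B‖ * (‖(Vn n ω).2.1 - A₀‖ + (Vn n ω).2.2 * ρ) * ‖θ - θ'‖ := by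
      intro ρ hρ θ hθ θ' hθ'
      rw [e2, e3]
      exact norm_newtonStep_sub_le hB (fun i => hω i ρ hρ) hθ hθ'
    obtain ⟨u1, u2, u3⟩ := hn
    have hhalf : ∀ θ ∈ Metric.closedBall θ₀ r, ∀ θ' ∈ Metric.closedBall θ₀ r,
        ‖newtonStep ψ B (fun i : Fin n => Y i ω) θ - newtonStep ψ B (fun i : Fin n => Y i ω) θ'‖ ≤
        2⁻¹ * ‖θ - θ'‖ := by
      intro θ hθ θ' hθ'
      refine (hlip r hrc θ hθ θ' hθ').trans (mul_le_mul_of_nonneg_right ?_ (norm_nonneg _))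
      rw [mul_add]
      linarith
    have hfix := htfix n (fun i => Y i ω) hhalf (by rw [e0]; exact u3.le)
    refine ⟨hfix, ?_⟩
    set τ := t n fun i => Y i ω with hτ
    have hτr : τ ∈ Metric.closedBall θ₀ r := htmem _ _
    have hdec : τ - θ₀ - B (Vn n ω).1 = newtonStep ψ B (fun i : Fin n => Y i ω) τ -
        newtonStep ψ B (fun i : Fin n => Y i ω) θ₀ := by
      rw [hfix, ← e0]; abel
    have hτ2 : ‖τ - θ₀‖ ≤ 2 * ‖B (Vn n ω).1‖ := by
      have h1 := hhalf τ hτr θ₀ (Metric.mem_closedBall_self hr0.le)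
      rw [← hdec] at h1
      have h2 := norm_sub_norm_le (τ - θ₀) (B (Vn n ω).1)
      linarith
    rw [hdec]
    -- The radius is now `‖τ - θ₀‖` instead of `r`, so the Lipschitz factor itself tends to zero.
    refine (hlip ‖τ - θ₀‖ ((mem_closedBall_iff_norm.1 hτr).trans hrc) τ
      (mem_closedBall_iff_norm.2 le_rfl) θ₀ (Metric.mem_closedBall_self (norm_nonneg _))).trans ?_
    have h5 : (Vn n ω).2.2 * ‖τ - θ₀‖ ≤ |(Vn n ω).2.2| * (2 * ‖B (Vn n ω).1‖) :=
      (mul_le_mul_of_nonneg_right (le_abs_self _) (norm_nonneg _)).trans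
        (mul_le_mul_of_nonneg_left hτ2 (abs_nonneg _))
    calc _ ≤ ‖B‖ * (‖(Vn n ω).2.1 - A₀‖ + |(Vn n ω).2.2| * (2 * ‖B (Vn n ω).1‖)) *
          (2 * ‖B (Vn n ω).1‖) := by gcongr
      _ = κ (Vn n ω) * ‖B (Vn n ω).1‖ := by simp only [κ]; ring
  have hbad := TendstoInMeasure.tendsto_measure_notMem hVn hU
  refine ⟨t, htm, fun n y => Metric.closedBall_subset_closedBall hrc (htmem n y), ?_, ?_⟩
  · refine tendsto_of_tendsto_of_tendsto_of_le_of_le' tendsto_const_nhds hbad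
      (Eventually.of_forall fun _ => zero_le) ?_
    filter_upwards [eventually_gt_atTop 0] with n hn
    refine measure_mono_ae ?_
    filter_upwards [main] with ω hω hne hmem
    refine hne ?_
    -- At a fixed point `B` kills the average; injectivity of `B` and `n ≠ 0` then make the sum
    -- itself vanish.
    have h1 := (hω n hmem).1
    rw [newtonStep, add_eq_left] at h1
    have h2 := hBinj (h1.trans (map_zero B).symm)
    rw [smul_eq_zero] at h2
    refine h2.resolve_left ?_
    positivity
  · have htY : ∀ n : ℕ, AEMeasurable (fun ω => t n fun i => Y i ω) P := fun n =>
      (htm n).comp_aemeasurable (aemeasurable_pi_lambda _ fun i => hYm i)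
    refine tendstoInDistribution_of_tendstoInMeasure_sub _ _ hW ?_
      fun n => ((htY n).sub_const _).const_smul _
    -- Slutsky: a factor `κ (Vn)` tending to zero in probability times the norm of a sequence
    -- converging in law.
    have hsl := TendstoInDistribution.continuous_comp_prodMk_of_tendstoInMeasure_const
      (g := fun x : E × (E × (E →L[ℝ] E) × ℝ) => κ x.2 * ‖x.1‖) (by fun_prop) hW hVn
      fun n => (hVnm n).aemeasurable
    have hκ0 : κ v₀ = 0 := by simp [κ, v₀]
    simp only [hκ0, zero_mul] at hsl
    rw [tendstoInMeasure_iff_norm]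
    intro ε hε
    have h1 := (TendstoInDistribution.tendsto_measure_le_zero hsl hε).add hbad
    rw [add_zero] at h1
    refine tendsto_of_tendsto_of_tendsto_of_le_of_le tendsto_const_nhds h1
      (fun _ => zero_le) fun n => ?_
    refine le_trans (measure_mono_ae ?_) (measure_union_le _ _)
    filter_upwards [main] with ω hω hε
    by_cases hmem : Vn n ω ∈ U
    · left
      have h2 := (hω n hmem).2
      have e1 : (n : ℝ)⁻¹ • ∑ i ∈ Finset.range n, ψ (Y i ω) θ₀ = (Vn n ω).1 := by
        simp [Vn, V, Prod.fst_sum]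
      change ε ≤ ‖√(n : ℝ) • (t n (fun i => Y i ω) - θ₀) -
        √(n : ℝ) • B ((n : ℝ)⁻¹ • ∑ i ∈ Finset.range n, ψ (Y i ω) θ₀) - 0‖ at hε
      change ε ≤ κ (Vn n ω) *
        ‖√(n : ℝ) • B ((n : ℝ)⁻¹ • ∑ i ∈ Finset.range n, ψ (Y i ω) θ₀)‖
      rw [e1] at hε ⊢
      rw [sub_zero, ← smul_sub, norm_smul] at hε
      rw [norm_smul]
      refine hε.trans ?_
      rw [mul_left_comm]
      exact mul_le_mul_of_nonneg_left h2 (norm_nonneg _)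
    · right; exact hmem

end EstimatingEquation

open scoped RealInnerProductSpace

/-! ### Multivariate central limit theorem -/

section CentralLimit

variable {E : Type*} [NormedAddCommGroup E] [InnerProductSpace ℝ E] [FiniteDimensional ℝ E]
  [MeasurableSpace E] [BorelSpace E]

/-- The central limit theorem for centered random vectors, the limit law being given by its
characteristic function. -/
theorem tendstoInDistribution_sqrt_smul_average {Ω : Type*} [MeasurableSpace Ω] {P : Measure Ω}
    [IsProbabilityMeasure P] {X : ℕ → Ω → E} (hX : MemLp (X 0) 2 P) (h0 : P[X 0] = 0)
    (hindep : iIndepFun X P) (hident : ∀ i, IdentDistrib (X i) (X 0) P P)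
    {Ω' : Type*} [MeasurableSpace Ω'] {P' : Measure Ω'} [IsProbabilityMeasure P'] {W : Ω' → E}
    (hW : AEMeasurable W P') (hchar : ∀ t : E, charFun (P'.map W) t =
      Complex.exp (-(Var[fun ω => ⟪X 0 ω, t⟫; P] : ℝ) / 2)) :
    TendstoInDistribution (fun (n : ℕ) ω => √(n : ℝ) • ((n : ℝ)⁻¹ • ∑ i ∈ Finset.range n, X i ω))
      atTop W (fun _ => P) P' where
  forall_aemeasurable n := ((Finset.aemeasurable_fun_sum _ fun i _ =>
      (hident i).aemeasurable_fst).const_smul _).const_smul _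
  aemeasurable_limit := hW
  tendsto := by
    have hm : ∀ n : ℕ, AEMeasurable
        (fun ω => √(n : ℝ) • ((n : ℝ)⁻¹ • ∑ i ∈ Finset.range n, X i ω)) P := fun n =>
      ((Finset.aemeasurable_fun_sum _ fun i _ =>
        (hident i).aemeasurable_fst).const_smul _).const_smul _
    -- Cramér–Wold: the characteristic function at `t` is that of the projection on `t` at the point
    -- 1, to which the scalar theorem applies.
    refine ProbabilityMeasure.tendsto_iff_tendsto_charFun.2 fun t => ?_
    have hg : Measurable fun x : E => ⟪x, t⟫ := by fun_prop
    have hid : HasLaw (fun x : ℝ => x)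
        (gaussianReal 0 Var[fun ω => ⟪X 0 ω, t⟫; P].toNNReal)
        (gaussianReal 0 Var[fun ω => ⟪X 0 ω, t⟫; P].toNNReal) :=
      ⟨aemeasurable_id, Measure.map_id⟩
    have h1 := tendstoInDistribution_inv_sqrt_mul_sum_sub (X := fun i ω => ⟪X i ω, t⟫) hid
      (hX.inner_const t) (hindep.comp (fun _ x => ⟪x, t⟫) fun _ => hg)
      fun i => (hident i).comp hg
    have hmean : ∫ ω, ⟪X 0 ω, t⟫ ∂P = 0 := by
      have := integral_inner (𝕜 := ℝ) (hX.integrable (by norm_num)) t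
      simp_rw [real_inner_comm t] at this ⊢
      rw [this, h0, inner_zero_right]
    have h2 := ProbabilityMeasure.tendsto_iff_tendsto_charFun.1 h1.tendsto 1
    simp only [ProbabilityMeasure.coe_mk, hid.map_eq] at h2 ⊢
    rw [charFun_gaussianReal] at h2
    rw [hchar]
    convert h2 using 2 with n
    · rw [charFun_apply, charFun_apply, integral_map (hm n) (by fun_prop),
        integral_map (h1.forall_aemeasurable n) (by fun_prop)]
      refine integral_congr_ae (Eventually.of_forall fun ω => ?_)
      have : ⟪√(n : ℝ) • ((n : ℝ)⁻¹ • ∑ i ∈ Finset.range n, X i ω), t⟫ =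
          (√(n : ℝ))⁻¹ * (∑ i ∈ Finset.range n, ⟪X i ω, t⟫ - n * ∫ ω, ⟪X 0 ω, t⟫ ∂P) := by
        rw [hmean, mul_zero, sub_zero, ← sum_inner, smul_smul, real_inner_smul_left]
        congr 1
        rw [← div_eq_mul_inv, Real.sqrt_div_self]
      simp only [this]
      simp
    · congr 1
      simp [Real.coe_toNNReal _ (variance_nonneg _ _), neg_div]

end CentralLimit

/-! ### Taylor estimates -/

section Calculus

variable {p : ℕ}

/-- Expanding the three arguments in the standard basis gives `p ^ 3` terms, each a partial
derivative times coordinates bounded by norms. -/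
theorem norm_iteratedFDeriv_three_le {g : EuclideanSpace ℝ (Fin p) → ℝ}
    {θ : EuclideanSpace ℝ (Fin p)} {M : ℝ} (hM : 0 ≤ M)
    (h : ∀ a b d, |partial3 a b d g θ| ≤ M) : ‖iteratedFDeriv ℝ 3 g θ‖ ≤ (p : ℝ) ^ 3 * M := by
  refine ContinuousMultilinearMap.opNorm_le_bound (by positivity) fun v => ?_
  have hv : v = fun i => ∑ a, v i a • EuclideanSpace.single a (1 : ℝ) := by
    funext i
    have := ((EuclideanSpace.basisFun (Fin p) ℝ).sum_repr (v i)).symm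
    simpa using this
  conv_lhs => rw [hv]
  rw [ContinuousMultilinearMap.map_sum]
  refine (norm_sum_le _ _).trans ?_
  have hterm : ∀ s : Fin 3 → Fin p, ‖iteratedFDeriv ℝ 3 g θ
      fun i => v i (s i) • EuclideanSpace.single (s i) (1 : ℝ)‖ ≤ M * ∏ i, ‖v i‖ := by
    intro s
    rw [ContinuousMultilinearMap.map_smul_univ, norm_smul, mul_comm, norm_prod]
    refine mul_le_mul ?_ (Finset.prod_le_prod (fun _ _ => norm_nonneg _) fun i _ =>
      PiLp.norm_apply_le (v i) (s i)) (by positivity) hM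
    have hs : (fun i => EuclideanSpace.single (s i) (1 : ℝ)) = ![EuclideanSpace.single (s 0) 1,
        EuclideanSpace.single (s 1) 1, EuclideanSpace.single (s 2) 1] := by
      funext i
      fin_cases i <;> rfl
    rw [hs]
    exact h (s 0) (s 1) (s 2)
  refine (Finset.sum_le_sum fun s _ => hterm s).trans ?_
  rw [Finset.sum_const, Finset.card_univ, Fintype.card_fun]
  simp [mul_assoc]

/-- A quantitative first-order expansion: the second derivative bounds the variation of the
first one. -/
theorem norm_sub_sub_fderiv_le {E F : Type*} [NormedAddCommGroup E] [NormedSpace ℝ E]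
    [NormedAddCommGroup F] [NormedSpace ℝ F] {D : E → F} {θ₀ : E} {c K : ℝ} (hK : 0 ≤ K)
    (hD : ∀ θ ∈ Metric.ball θ₀ c, ContDiffAt ℝ 2 D θ)
    (h : ∀ θ ∈ Metric.ball θ₀ c, ‖iteratedFDeriv ℝ 2 D θ‖ ≤ K) {ρ : ℝ} (hρ : ρ < c)
    {θ θ' : E} (hθ : θ ∈ Metric.closedBall θ₀ ρ) (hθ' : θ' ∈ Metric.closedBall θ₀ ρ) :
    ‖D θ - D θ' - fderiv ℝ D θ₀ (θ - θ')‖ ≤ K * ρ * ‖θ - θ'‖ := by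
  have hρ0 : 0 ≤ ρ := dist_nonneg.trans hθ
  have hsub : Metric.closedBall θ₀ ρ ⊆ Metric.ball θ₀ c := Metric.closedBall_subset_ball hρ
  have hD2 : ∀ x ∈ Metric.ball θ₀ c, ContDiffAt ℝ 1 (fderiv ℝ D) x := fun x hx =>
    (hD x hx).fderiv_right (by norm_num)
  have hbound : ∀ x ∈ Metric.closedBall θ₀ ρ, ‖fderiv ℝ (fderiv ℝ D) x‖ ≤ K := by
    intro x hx
    rw [← norm_iteratedFDeriv_one, norm_iteratedFDeriv_fderiv]
    exact h x (hsub hx)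
  -- The mean value inequality is used twice: here for the derivative, then for `D` minus its
  -- linearization at `θ₀`.
  have hlip : ∀ x ∈ Metric.closedBall θ₀ ρ, ‖fderiv ℝ D x - fderiv ℝ D θ₀‖ ≤ K * ρ := by
    intro x hx
    refine ((convex_closedBall θ₀ ρ).norm_image_sub_le_of_norm_fderiv_le
      (fun x hx => (hD2 x (hsub hx)).differentiableAt (by norm_num)) hbound
      (Metric.mem_closedBall_self hρ0) hx).trans ?_
    exact mul_le_mul_of_nonneg_left (mem_closedBall_iff_norm.1 hx) hK
  exact (convex_closedBall θ₀ ρ).norm_image_sub_le_of_norm_fderiv_le'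
    (fun x hx => (hD x (hsub hx)).differentiableAt (by norm_num)) hlip hθ' hθ

theorem fderiv_fderiv_single {g : EuclideanSpace ℝ (Fin p) → ℝ} {θ : EuclideanSpace ℝ (Fin p)}
    (a b : Fin p) : fderiv ℝ (fderiv ℝ g) θ (EuclideanSpace.single a 1)
      (EuclideanSpace.single b 1) = partial2 a b g θ := by
  rw [partial2, iteratedFDeriv_two_apply]
  rfl

end Calculus

/-! ### Gradients, Hessians and their measurability -/

section Gradient

variable {p : ℕ}

theorem contDiffAt_gradient {g : EuclideanSpace ℝ (Fin p) → ℝ} {θ : EuclideanSpace ℝ (Fin p)}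
    (hg : ContDiffAt ℝ 3 g θ) : ContDiffAt ℝ 2 (gradient g) θ :=
  (InnerProductSpace.toDual ℝ (EuclideanSpace ℝ (Fin p))).symm.contDiff.contDiffAt.comp θ
    (hg.fderiv_right (m := 2) (by norm_num))

theorem norm_iteratedFDeriv_gradient (g : EuclideanSpace ℝ (Fin p) → ℝ)
    (θ : EuclideanSpace ℝ (Fin p)) :
    ‖iteratedFDeriv ℝ 2 (gradient g) θ‖ = ‖iteratedFDeriv ℝ 3 g θ‖ := by
  have h := (InnerProductSpace.toDual ℝ (EuclideanSpace ℝ (Fin p))).symm.norm_iteratedFDeriv_comp_left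
    (fderiv ℝ g) θ 2
  rw [norm_iteratedFDeriv_fderiv] at h
  exact h

/-- The second derivative of `g` at `θ` as an operator, assembled from its partial derivatives. -/
noncomputable def hessianCLM (g : EuclideanSpace ℝ (Fin p) → ℝ) (θ : EuclideanSpace ℝ (Fin p)) :
    EuclideanSpace ℝ (Fin p) →L[ℝ] EuclideanSpace ℝ (Fin p) :=
  ∑ a, ∑ b, partial2 a b g θ • (EuclideanSpace.proj a).smulRight (EuclideanSpace.single b (1 : ℝ))

/-- `hessianCLM` makes sense without differentiability and is integrated entry by entry; here it is
identified, through the Riesz isomorphism, with the derivative needed in the expansion. -/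
theorem fderiv_gradient {g : EuclideanSpace ℝ (Fin p) → ℝ} {θ : EuclideanSpace ℝ (Fin p)}
    (hg : ContDiffAt ℝ 3 g θ) : fderiv ℝ (gradient g) θ = hessianCLM g θ := by
  have hd : DifferentiableAt ℝ (fderiv ℝ g) θ :=
    (hg.fderiv_right (m := 2) (by norm_num)).differentiableAt (by norm_num)
  have hd' : DifferentiableAt ℝ (gradient g) θ :=
    (contDiffAt_gradient hg).differentiableAt (by norm_num)
  have h2 : ∀ v w, ⟪fderiv ℝ (gradient g) θ v, w⟫ = fderiv ℝ (fderiv ℝ g) θ v w := by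
    intro v w
    have e1 := hd'.hasFDerivAt.inner ℝ (hasFDerivAt_const w θ)
    have e2 := hd.hasFDerivAt.clm_apply (hasFDerivAt_const w θ)
    have e3 : (fun x => ⟪gradient g x, w⟫) = fun x => fderiv ℝ g x w :=
      funext fun x => InnerProductSpace.toDual_symm_apply
    rw [e3] at e1
    simpa using congrArg (fun T => T v) (e1.unique e2)
  have hv : ∀ v : EuclideanSpace ℝ (Fin p), v = ∑ a, v a • EuclideanSpace.single a (1 : ℝ) := by
    intro v
    have := ((EuclideanSpace.basisFun (Fin p) ℝ).sum_repr v).symm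
    simpa using this
  ext v b
  have h3 : (fderiv ℝ (gradient g) θ v) b =
      ⟪fderiv ℝ (gradient g) θ v, EuclideanSpace.single b (1 : ℝ)⟫ := by
    simp [EuclideanSpace.inner_single_right]
  rw [h3, h2]
  conv_lhs => rw [hv v]
  simp only [map_sum, map_smul, sum_apply, smul_apply, fderiv_fderiv_single, hessianCLM,
    ContinuousLinearMap.smulRight_apply, PiLp.proj_apply, WithLp.ofLp_sum,
    Finset.sum_apply, PiLp.smul_apply, smul_eq_mul, PiLp.single_apply]
  refine Finset.sum_congr rfl fun a _ => ?_
  simp [mul_comm]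

theorem norm_gradient_sub_sub_hessianCLM_le {g : EuclideanSpace ℝ (Fin p) → ℝ}
    {θ₀ : EuclideanSpace ℝ (Fin p)} {c K : ℝ} (hc : 0 < c) (hK : 0 ≤ K)
    (hg : ∀ θ ∈ Metric.ball θ₀ c, ContDiffAt ℝ 3 g θ)
    (h : ∀ θ ∈ Metric.ball θ₀ c, ‖iteratedFDeriv ℝ 3 g θ‖ ≤ K) {ρ : ℝ} (hρ : ρ < c)
    {θ θ' : EuclideanSpace ℝ (Fin p)} (hθ : θ ∈ Metric.closedBall θ₀ ρ)
    (hθ' : θ' ∈ Metric.closedBall θ₀ ρ) :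
    ‖gradient g θ - gradient g θ' - hessianCLM g θ₀ (θ - θ')‖ ≤ K * ρ * ‖θ - θ'‖ := by
  rw [← fderiv_gradient (hg θ₀ (Metric.mem_ball_self hc))]
  exact norm_sub_sub_fderiv_le hK (fun x hx => contDiffAt_gradient (hg x hx))
    (fun x hx => (norm_iteratedFDeriv_gradient g x).trans_le (h x hx)) hρ hθ hθ'

/-- The first-order Taylor expansion with a quadratic remainder. -/
theorem abs_sub_sub_inner_gradient_le {g : EuclideanSpace ℝ (Fin p) → ℝ}
    {θ₀ : EuclideanSpace ℝ (Fin p)} {c K : ℝ} (hc : 0 < c) (hK : 0 ≤ K)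
    (hg : ∀ θ ∈ Metric.ball θ₀ c, ContDiffAt ℝ 3 g θ)
    (h : ∀ θ ∈ Metric.ball θ₀ c, ‖iteratedFDeriv ℝ 3 g θ‖ ≤ K)
    {δ : EuclideanSpace ℝ (Fin p)} (hδ : ‖δ‖ < c) :
    |g (θ₀ + δ) - g θ₀ - ⟪gradient g θ₀, δ⟫| ≤ (‖hessianCLM g θ₀‖ + K * c) * ‖δ‖ ^ 2 := by
  have hd : ∀ x ∈ Metric.closedBall θ₀ ‖δ‖, DifferentiableAt ℝ g x := fun x hx =>
    (hg x (Metric.closedBall_subset_ball hδ hx)).differentiableAt (by norm_num)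
  have hbound : ∀ x ∈ Metric.closedBall θ₀ ‖δ‖, ‖fderiv ℝ g x - fderiv ℝ g θ₀‖ ≤
      (‖hessianCLM g θ₀‖ + K * c) * ‖δ‖ := by
    intro x hx
    have h1 := norm_gradient_sub_sub_hessianCLM_le hc hK hg h hδ hx
      (Metric.mem_closedBall_self (norm_nonneg _))
    have hx' := mem_closedBall_iff_norm.1 hx
    have h2 : ‖fderiv ℝ g x - fderiv ℝ g θ₀‖ = ‖gradient g x - gradient g θ₀‖ := by
      rw [gradient, gradient, ← map_sub, LinearIsometryEquiv.norm_map]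
    rw [h2]
    have h3 := norm_sub_norm_le (gradient g x - gradient g θ₀) (hessianCLM g θ₀ (x - θ₀))
    have h4 := (hessianCLM g θ₀).le_opNorm (x - θ₀)
    have h5 : ‖hessianCLM g θ₀‖ * ‖x - θ₀‖ ≤ ‖hessianCLM g θ₀‖ * ‖δ‖ := by gcongr
    have h6 : K * ‖δ‖ * ‖x - θ₀‖ ≤ K * c * ‖δ‖ := by gcongr
    linarith
  have := (convex_closedBall θ₀ ‖δ‖).norm_image_sub_le_of_norm_fderiv_le' hd hbound
    (Metric.mem_closedBall_self (norm_nonneg _)) (y := θ₀ + δ) (by simp)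
  rw [add_sub_cancel_left, Real.norm_eq_abs] at this
  rw [show ⟪gradient g θ₀, δ⟫ = fderiv ℝ g θ₀ δ from InnerProductSpace.toDual_symm_apply]
  refine this.trans_eq ?_
  ring

/-- Measurability of a gradient with respect to a parameter. -/
theorem measurable_indicator_gradient {S : Type*} [MeasurableSpace S]
    {ℓ : S → EuclideanSpace ℝ (Fin p) → ℝ} {G : Set S} (hG : MeasurableSet G)
    {U : Set (EuclideanSpace ℝ (Fin p))} {θ : EuclideanSpace ℝ (Fin p)} (hU : U ∈ 𝓝 θ)
    (hℓ : ∀ θ ∈ U, Measurable fun y => ℓ y θ) (hd : ∀ y ∈ G, DifferentiableAt ℝ (ℓ y) θ) :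
    Measurable fun y => G.indicator (fun y => gradient (ℓ y) θ) y := by
  have hpart : ∀ v, Measurable fun y => G.indicator (fun y => fderiv ℝ (ℓ y) θ v) y := by
    intro v
    have htend : Tendsto (fun k : ℕ => θ + (k : ℝ)⁻¹ • v) atTop (𝓝 θ) := by
      have : Tendsto (fun k : ℕ => θ + (k : ℝ)⁻¹ • v) atTop (𝓝 (θ + (0 : ℝ) • v)) :=
        tendsto_const_nhds.add ((tendsto_inv_atTop_nhds_zero_nat (𝕜 := ℝ)).smul_const v)
      simpa using this
    -- Starting the difference quotients at `k₀` keeps their points in `U`, where measurability in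
    -- `y` is available.
    obtain ⟨k₀, hk₀⟩ := eventually_atTop.1 (htend.eventually_mem hU)
    refine measurable_of_tendsto_metrizable (f := fun k : ℕ => G.indicator
      fun y => ((k + k₀ : ℕ) : ℝ) • (ℓ y (θ + ((k + k₀ : ℕ) : ℝ)⁻¹ • v) - ℓ y θ)) (fun k => ?_) ?_
    · exact Measurable.indicator (Measurable.const_smul
        ((hℓ _ (hk₀ _ (Nat.le_add_left k₀ k))).sub (hℓ _ (mem_of_mem_nhds hU)))
        ((k + k₀ : ℕ) : ℝ)) hG
    · rw [tendsto_pi_nhds]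
      intro y
      by_cases hy : y ∈ G
      · simp only [hy, Set.indicator_of_mem]
        exact (((hd y hy).hasFDerivAt.lim_real v).comp tendsto_natCast_atTop_atTop).comp
          (tendsto_add_atTop_nat k₀)
      · simp [hy]
  have hrep : (fun y => G.indicator (fun y => gradient (ℓ y) θ) y) = fun y =>
      ∑ a, G.indicator (fun y => fderiv ℝ (ℓ y) θ (EuclideanSpace.single a 1)) y •
        EuclideanSpace.single a (1 : ℝ) := by
    funext y
    by_cases hy : y ∈ G
    · simp only [hy, Set.indicator_of_mem]
      have h1 := ((EuclideanSpace.basisFun (Fin p) ℝ).sum_repr (gradient (ℓ y) θ)).symm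
      conv_lhs => rw [h1]
      refine Finset.sum_congr rfl fun a _ => ?_
      have h2 : fderiv ℝ (ℓ y) θ (EuclideanSpace.single a 1) =
          ⟪gradient (ℓ y) θ, EuclideanSpace.single a 1⟫ :=
        InnerProductSpace.toDual_symm_apply.symm
      have h3 : ∀ x : EuclideanSpace ℝ (Fin p), ⟪x, EuclideanSpace.single a (1 : ℝ)⟫ = x a :=
        fun x => by simp [EuclideanSpace.inner_single_right]
      rw [h2, h3]
      simp
    · simp [hy]
  rw [hrep]
  exact Finset.measurable_fun_sum _ fun a _ => (hpart _).smul_const _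

end Gradient

/-! ### Retraction used to extend the score to the whole space -/

section Retraction

variable {E : Type*} [NormedAddCommGroup E] [NormedSpace ℝ E]

/-- The radial retraction onto the closed ball of radius `r` around `θ₀`. -/
noncomputable def radialRetraction (θ₀ : E) (r : ℝ) (θ : E) : E :=
  θ₀ + (r / max r ‖θ - θ₀‖) • (θ - θ₀)

theorem continuous_radialRetraction (θ₀ : E) {r : ℝ} (hr : 0 < r) :
    Continuous (radialRetraction θ₀ r) := by
  have h : ∀ θ, max r ‖θ - θ₀‖ ≠ 0 := fun θ => (hr.trans_le (le_max_left _ _)).ne'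
  unfold radialRetraction
  fun_prop (disch := exact h _)

theorem radialRetraction_mem (θ₀ : E) {r : ℝ} (hr : 0 < r) (θ : E) :
    radialRetraction θ₀ r θ ∈ Metric.closedBall θ₀ r := by
  have h : 0 < max r ‖θ - θ₀‖ := hr.trans_le (le_max_left _ _)
  rw [mem_closedBall_iff_norm, radialRetraction, add_sub_cancel_left, norm_smul, norm_div,
    Real.norm_of_nonneg hr.le, Real.norm_of_nonneg h.le, div_mul_eq_mul_div, div_le_iff₀ h]
  exact mul_le_mul_of_nonneg_left (le_max_right _ _) hr.le

theorem radialRetraction_eq_self {θ₀ : E} {r : ℝ} (hr : 0 < r) {θ : E}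
    (hθ : θ ∈ Metric.closedBall θ₀ r) : radialRetraction θ₀ r θ = θ := by
  rw [radialRetraction, max_eq_left (mem_closedBall_iff_norm.1 hθ), div_self hr.ne', one_smul,
    add_sub_cancel]

end Retraction

/-! ### A variational criterion for mean zero -/

section MeanZero

/-- An integrable vector all of whose linear functionals are, up to a quadratic error, dominated
by functions with nonpositive mean is centered. -/
theorem integral_eq_zero_of_inner_le {S E : Type*} [MeasurableSpace S] {Q : Measure S}
    [NormedAddCommGroup E] [InnerProductSpace ℝ E] [CompleteSpace E] {u : S → E} {C : S → ℝ}
    {c : ℝ} (hc : 0 < c) (hu : Integrable u Q) (hC : Integrable C Q)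
    (h : ∀ δ : E, ‖δ‖ < c → ∃ R : S → ℝ, Integrable R Q ∧ ∫ y, R y ∂Q ≤ 0 ∧
      ∀ᵐ y ∂Q, ⟪u y, δ⟫ ≤ R y + C y * ‖δ‖ ^ 2) : ∫ y, u y ∂Q = 0 := by
  set v := ∫ y, u y ∂Q with hv
  have key : ∀ δ : E, ‖δ‖ < c → ⟪v, δ⟫ ≤ (∫ y, C y ∂Q) * ‖δ‖ ^ 2 := by
    intro δ hδ
    obtain ⟨R, hR, hR0, hle⟩ := h δ hδ
    have h1 : ⟪v, δ⟫ = ∫ y, ⟪u y, δ⟫ ∂Q := by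
      have := integral_inner (𝕜 := ℝ) hu δ
      simp_rw [real_inner_comm δ] at this ⊢
      exact this.symm
    have h2 : ∫ y, ⟪u y, δ⟫ ∂Q ≤ ∫ y, (R y + C y * ‖δ‖ ^ 2) ∂Q :=
      integral_mono_ae (hu.inner_const δ) (hR.add (hC.mul_const _)) hle
    rw [integral_add hR (hC.mul_const _), integral_mul_const] at h2
    linarith
  by_contra hne
  have hpos : 0 < ‖v‖ := norm_pos_iff.2 hne
  -- Testing with `δ = s • v` gives `s ‖v‖² ≤ s² ‖v‖² ∫ C`, which fails for small `s > 0` unless `v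
  -- = 0`.
  have hev : ∀ᶠ s : ℝ in 𝓝[>] 0, s * ‖v‖ < c ∧ s * ∫ y, C y ∂Q < 1 := by
    refine Filter.Eventually.filter_mono nhdsWithin_le_nhds (Filter.Eventually.and ?_ ?_)
    · exact (Continuous.tendsto (f := fun s : ℝ => s * ‖v‖) (by fun_prop) 0).eventually_lt_const
        (by simpa using hc)
    · exact (Continuous.tendsto (f := fun s : ℝ => s * ∫ y, C y ∂Q) (by fun_prop)
        0).eventually_lt_const (by simp)
  obtain ⟨s, ⟨hs1, hs2⟩, hs0 : 0 < s⟩ := (hev.and self_mem_nhdsWithin).exists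
  have h1 := key (s • v) (by rwa [norm_smul, Real.norm_of_nonneg hs0.le])
  rw [inner_smul_right, real_inner_self_eq_norm_sq, norm_smul, Real.norm_of_nonneg hs0.le] at h1
  have h2 : s * ‖v‖ ^ 2 * (1 - s * ∫ y, C y ∂Q) ≤ 0 := by nlinarith
  have h3 : 0 < s * ‖v‖ ^ 2 * (1 - s * ∫ y, C y ∂Q) :=
    mul_pos (by positivity) (by linarith)
  linarith

end MeanZero

/-! ### Kullback–Leibler inequality and smoothness of the cluster likelihood -/

namespace CompositeLikelihood

variable {m p : ℕ} {𝓨 : Type*} [MeasurableSpace 𝓨] {ν : Measure 𝓨}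
  {Θ : Set (EuclideanSpace ℝ (Fin p))} {f : Fin m → 𝓨 → EuclideanSpace ℝ (Fin p) → ℝ}
  {Q : Measure (Fin m → 𝓨)} {θ₀ : EuclideanSpace ℝ (Fin p)}

theorem CorrectlySpecified.measurable_clusterLogLik (h : CorrectlySpecified ν Θ f Q θ₀)
    {θ : EuclideanSpace ℝ (Fin p)} (hθ : θ ∈ Θ) : Measurable fun y => clusterLogLik f y θ :=
  Finset.measurable_fun_sum _ fun j _ =>
    Real.measurable_log.comp ((h.measurable j θ hθ).comp (measurable_pi_apply j))

theorem CorrectlySpecified.ae_pos (h : CorrectlySpecified ν Θ f Q θ₀) (j : Fin m) :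
    ∀ᵐ y ∂Q, 0 < f j (y j) θ₀ := by
  have hm := h.measurable j θ₀ h.true_mem
  refine ae_of_ae_map (f := fun y : Fin m → 𝓨 => y j) (p := fun x => 0 < f j x θ₀)
    (measurable_pi_apply j).aemeasurable ?_
  rw [h.marginal_eq j]
  refine (ae_withDensity_iff hm.ennreal_ofReal).2 (Eventually.of_forall fun x hx => ?_)
  simpa using hx

/-- Against the true marginal the ratio integrates to the `ν`-mass of `f j · θ` on the set where `f
j · θ₀` is nonzero. Division by zero gives 0, hence an inequality. -/
theorem CorrectlySpecified.lintegral_ratio_le (h : CorrectlySpecified ν Θ f Q θ₀) (j : Fin m)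
    {θ : EuclideanSpace ℝ (Fin p)} (hθ : θ ∈ Θ) :
    ∫⁻ y, ENNReal.ofReal (f j (y j) θ / f j (y j) θ₀) ∂Q ≤ 1 := by
  have hm := h.measurable j θ hθ
  have hm0 := h.measurable j θ₀ h.true_mem
  have h1 : ∫⁻ y, ENNReal.ofReal (f j (y j) θ / f j (y j) θ₀) ∂Q =
      ∫⁻ x, ENNReal.ofReal (f j x θ / f j x θ₀) ∂(Q.map fun y => y j) :=
    (lintegral_map (hm.div hm0).ennreal_ofReal (measurable_pi_apply j)).symm
  have hratio : Measurable fun x => ENNReal.ofReal (f j x θ / f j x θ₀) :=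
    (hm.div hm0).ennreal_ofReal
  rw [h1, h.marginal_eq j, lintegral_withDensity_eq_lintegral_mul _ hm0.ennreal_ofReal hratio,
    ← h.lintegral_eq_one j θ hθ]
  refine lintegral_mono fun x => ?_
  rw [Pi.mul_apply, ← ENNReal.ofReal_mul (h.nonneg j θ₀ h.true_mem x)]
  refine ENNReal.ofReal_le_ofReal ?_
  rcases eq_or_ne (f j x θ₀) 0 with h0 | h0
  · simpa [h0] using h.nonneg j θ hθ x
  · rw [mul_div_cancel₀ _ h0]

/-- The composite Kullback–Leibler inequality: the composite log-likelihood ratio is dominated by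
an integrable function of nonpositive mean. -/
theorem CorrectlySpecified.exists_logLik_sub_le [IsProbabilityMeasure Q]
    (h : CorrectlySpecified ν Θ f Q θ₀)
    (hsupp : ∀ j, ∀ θ₁ ∈ Θ, ∀ θ₂ ∈ Θ, {y | 0 < f j y θ₁} = {y | 0 < f j y θ₂})
    {θ : EuclideanSpace ℝ (Fin p)} (hθ : θ ∈ Θ) :
    ∃ R : (Fin m → 𝓨) → ℝ, Integrable R Q ∧ ∫ y, R y ∂Q ≤ 0 ∧
      ∀ᵐ y ∂Q, clusterLogLik f y θ - clusterLogLik f y θ₀ ≤ R y := by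
  have hnn : ∀ j (y : Fin m → 𝓨), 0 ≤ f j (y j) θ / f j (y j) θ₀ := fun j y =>
    div_nonneg (h.nonneg j θ hθ _) (h.nonneg j θ₀ h.true_mem _)
  have hmeas : ∀ j, Measurable fun y : Fin m → 𝓨 => f j (y j) θ / f j (y j) θ₀ := fun j =>
    ((h.measurable j θ hθ).div (h.measurable j θ₀ h.true_mem)).comp (measurable_pi_apply j)
  have hint : ∀ j, Integrable (fun y => f j (y j) θ / f j (y j) θ₀) Q := fun j =>
    ⟨(hmeas j).aestronglyMeasurable, by
      rw [hasFiniteIntegral_iff_ofReal (Eventually.of_forall (hnn j))]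
      exact (h.lintegral_ratio_le j hθ).trans_lt ENNReal.one_lt_top⟩
  have hint1 : ∀ j, Integrable (fun y => f j (y j) θ / f j (y j) θ₀ - 1) Q := fun j =>
    (hint j).sub (integrable_const _)
  -- The dominating function comes from `log x ≤ x - 1`; it is integrable even if the log-likelihood
  -- is not.
  refine ⟨fun y => ∑ j, (f j (y j) θ / f j (y j) θ₀ - 1),
    integrable_finsetSum _ fun j _ => hint1 j, ?_, ?_⟩
  · rw [integral_finsetSum _ fun j _ => hint1 j]
    refine Finset.sum_nonpos fun j _ => ?_
    rw [integral_sub (hint j) (integrable_const _),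
      integral_eq_lintegral_of_nonneg_ae (Eventually.of_forall (hnn j))
        (hmeas j).aestronglyMeasurable]
    have := ENNReal.toReal_mono ENNReal.one_ne_top (h.lintegral_ratio_le j hθ)
    simpa using this
  · filter_upwards [ae_all_iff.2 h.ae_pos] with y hy
    rw [clusterLogLik, clusterLogLik, ← Finset.sum_sub_distrib]
    refine Finset.sum_le_sum fun j _ => ?_
    have hθpos : 0 < f j (y j) θ := by
      have : y j ∈ {x | 0 < f j x θ₀} := hy j
      rwa [hsupp j θ₀ h.true_mem θ hθ] at this
    rw [← Real.log_div hθpos.ne' (hy j).ne']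
    exact Real.log_le_sub_one_of_pos (div_pos hθpos (hy j))

/-- Outside a measurable null set the composite log-likelihood of a cluster is smooth around the
true value, with an integrable bound for the third derivative. -/
theorem Regular.exists_smooth_set (h : Regular Θ f Q θ₀) :
    ∃ (c : ℝ) (L : (Fin m → 𝓨) → ℝ) (G : Set (Fin m → 𝓨)), 0 < c ∧ Metric.closedBall θ₀ c ⊆ Θ ∧
      Integrable L Q ∧ (∀ y, 0 ≤ L y) ∧ MeasurableSet G ∧ G ∈ ae Q ∧
      ∀ y ∈ G, ∀ θ ∈ Metric.ball θ₀ c, ContDiffAt ℝ 3 (clusterLogLik f y) θ ∧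
        ‖iteratedFDeriv ℝ 3 (clusterLogLik f y) θ‖ ≤ L y := by
  obtain ⟨c, M, hc, hcΘ, hM, hdom⟩ := h.domination
  have hae : ∀ᵐ y ∂Q, ∀ j, ContDiffOn ℝ 3 (fun θ => Real.log (f j (y j) θ))
      (Metric.closedBall θ₀ c) ∧ ∀ θ ∈ Metric.ball θ₀ c, ∀ a b d : Fin p,
        |partial3 a b d (fun θ => Real.log (f j (y j) θ)) θ| ≤ M j (y j) :=
    ae_all_iff.2 fun j => ae_of_ae_map (measurable_pi_apply j).aemeasurable (hdom j)
  obtain ⟨G, hGae, hG, hGp⟩ := hae.exists_measurable_mem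
  -- `M j` may be negative off the good set, so absolute values keep `L` nonnegative everywhere.
  refine ⟨c, fun y => ∑ j, (p : ℝ) ^ 3 * |M j (y j)|, G, hc, hcΘ, ?_, fun y => by positivity, hG,
    hGae, fun y hy θ hθ => ?_⟩
  · exact integrable_finsetSum _ fun j _ =>
      ((hM j).comp_measurable (measurable_pi_apply j)).abs.const_mul _
  · have hcd : ∀ j, ContDiffAt ℝ 3 (fun θ => Real.log (f j (y j) θ)) θ := fun j =>
      (hGp y hy j).1.contDiffAt (mem_of_superset (Metric.isOpen_ball.mem_nhds hθ)
        Metric.ball_subset_closedBall)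
    refine ⟨ContDiffAt.sum fun j _ => hcd j, ?_⟩
    have h1 : iteratedFDeriv ℝ 3 (clusterLogLik f y) θ =
        ∑ j, iteratedFDeriv ℝ 3 (fun θ => Real.log (f j (y j) θ)) θ :=
      iteratedFDeriv_fun_sum_apply fun j _ => hcd j
    rw [h1]
    refine (norm_sum_le _ _).trans (Finset.sum_le_sum fun j _ => ?_)
    exact norm_iteratedFDeriv_three_le (abs_nonneg _) fun a b d =>
      ((hGp y hy j).2 θ hθ a b d).trans (le_abs_self _)

end CompositeLikelihood

theorem integral_sum_sum_smul {S ι F : Type*} [MeasurableSpace S] {Q : Measure S} [Fintype ι]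
    [NormedAddCommGroup F] [NormedSpace ℝ F] [CompleteSpace F] {g : ι → ι → S → ℝ}
    (hg : ∀ a b, Integrable (g a b) Q) (T : ι → ι → F) :
    Integrable (fun y => ∑ a, ∑ b, g a b y • T a b) Q ∧
      ∫ y, ∑ a, ∑ b, g a b y • T a b ∂Q = ∑ a, ∑ b, (∫ y, g a b y ∂Q) • T a b := by
  have h1 : ∀ a, Integrable (fun y => ∑ b, g a b y • T a b) Q := fun a =>
    integrable_finsetSum _ fun b _ => (hg a b).smul_const _
  refine ⟨integrable_finsetSum _ fun a _ => h1 a, ?_⟩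
  rw [integral_finsetSum _ fun a _ => h1 a]
  refine Finset.sum_congr rfl fun a _ => ?_
  rw [integral_finsetSum _ fun b _ => (hg a b).smul_const _]
  exact Finset.sum_congr rfl fun b _ => integral_smul_const _ _

/-! ### Covariance matrices as quadratic forms -/

section CovarianceMatrix

variable {S : Type*} [MeasurableSpace S] {Q : Measure S} [IsFiniteMeasure Q] {p : ℕ}
  {u : S → EuclideanSpace ℝ (Fin p)}

theorem variance_inner_eq (hu : ∀ a, MemLp (fun y => u y a) 2 Q) (w : EuclideanSpace ℝ (Fin p)) :
    Var[fun y => ⟪u y, w⟫; Q] =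
      w ⬝ᵥ (Matrix.of fun a b => cov[fun y => u y a, fun y => u y b; Q]).mulVec w := by
  have h1 : (fun y => ⟪u y, w⟫) = fun y => ∑ a, w a * u y a := by
    funext y
    simp [PiLp.inner_apply]
  have h2 : ∀ a, MemLp (fun y => w a * u y a) 2 Q := fun a => (hu a).const_mul _
  rw [h1, ← covariance_self
    (Finset.aemeasurable_fun_sum _ fun a _ => (h2 a).aestronglyMeasurable.aemeasurable),
    covariance_fun_sum_fun_sum h2 h2]
  simp only [dotProduct, Matrix.mulVec, Matrix.of_apply, Finset.mul_sum]
  refine Finset.sum_congr rfl fun a _ => Finset.sum_congr rfl fun b _ => ?_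
  rw [covariance_const_mul_left, covariance_const_mul_right]
  ring

theorem posSemidef_covarianceMatrix (hu : ∀ a, MemLp (fun y => u y a) 2 Q) :
    (Matrix.of fun a b => cov[fun y => u y a, fun y => u y b; Q]).PosSemidef := by
  refine Matrix.PosSemidef.of_dotProduct_mulVec_nonneg ?_ fun x => ?_
  · ext a b
    simp [covariance_comm]
  · have h := variance_inner_eq hu (WithLp.toLp 2 x)
    simp only [star_trivial]
    rw [← h]
    exact variance_nonneg _ _

end CovarianceMatrix

/-! ### Godambe information and the limit law -/

namespace CompositeLikelihood

variable {m p : ℕ} {𝓨 : Type*} [MeasurableSpace 𝓨]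
  {Θ : Set (EuclideanSpace ℝ (Fin p))} {f : Fin m → 𝓨 → EuclideanSpace ℝ (Fin p) → ℝ}
  {Q : Measure (Fin m → 𝓨)} {θ₀ : EuclideanSpace ℝ (Fin p)}

/-- The right side is the covariance of `H⁻¹` times the score, which is what the linearized
estimator produces. Invertibility of `J` removes the double inverse. -/
theorem Regular.godambe_inv (h : Regular Θ f Q θ₀) : (godambe f Q θ₀)⁻¹ =
    (sensitivityMatrix f Q θ₀)⁻¹ * variabilityMatrix f Q θ₀ * (sensitivityMatrix f Q θ₀)⁻¹ := by
  rw [godambe, Matrix.mul_inv_rev, Matrix.mul_inv_rev, Matrix.nonsing_inv_nonsing_inv,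
    Matrix.mul_assoc]
  exact (Matrix.isUnit_iff_isUnit_det _).1 h.variability_invertible

theorem Regular.inner_sensitivity_inv (h : Regular Θ f Q θ₀) (x t : EuclideanSpace ℝ (Fin p)) :
    ⟪Matrix.toEuclideanCLM (𝕜 := ℝ) (sensitivityMatrix f Q θ₀)⁻¹ x, t⟫ =
      ⟪x, Matrix.toEuclideanCLM (𝕜 := ℝ) (sensitivityMatrix f Q θ₀)⁻¹ t⟫ := by
  have hH : ((sensitivityMatrix f Q θ₀)⁻¹).IsHermitian := h.sensitivity_posDef.isHermitian.inv
  rw [real_inner_comm, Matrix.inner_toEuclideanCLM, Matrix.inner_toEuclideanCLM,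
    Matrix.dotProduct_mulVec, dotProduct_comm, ← Matrix.mulVec_transpose]
  congr 2

theorem Regular.integrable_hessianCLM (h : Regular Θ f Q θ₀) :
    Integrable (fun y => hessianCLM (clusterLogLik f y) θ₀) Q := by
  exact (integral_sum_sum_smul h.sensitivity_finite _).1

theorem Regular.integral_hessianCLM (h : Regular Θ f Q θ₀) :
    ∫ y, hessianCLM (clusterLogLik f y) θ₀ ∂Q =
      -Matrix.toEuclideanCLM (𝕜 := ℝ) (sensitivityMatrix f Q θ₀) := by
  -- `hessianCLM` contracts the first index while a matrix acting on a vector contracts the second;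
  -- symmetry of `H` reconciles them.
  have hsym : ∀ a b, sensitivityMatrix f Q θ₀ a b = sensitivityMatrix f Q θ₀ b a := fun a b => by
    simpa using h.sensitivity_posDef.isHermitian.apply b a
  have h1 : ∫ y, hessianCLM (clusterLogLik f y) θ₀ ∂Q =
      ∑ a, ∑ b, (∫ y, partial2 a b (clusterLogLik f y) θ₀ ∂Q) •
        (EuclideanSpace.proj a).smulRight (EuclideanSpace.single b (1 : ℝ)) := by
    exact (integral_sum_sum_smul h.sensitivity_finite _).2
  have h2 : ∀ a b, ∫ y, partial2 a b (clusterLogLik f y) θ₀ ∂Q = -sensitivityMatrix f Q θ₀ a b :=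
    fun a b => by simp [sensitivityMatrix, integral_neg]
  rw [h1]
  ext v b
  simp only [h2, sum_apply, smul_apply, neg_apply, ContinuousLinearMap.smulRight_apply,
    PiLp.proj_apply, WithLp.ofLp_sum, Finset.sum_apply, PiLp.smul_apply, smul_eq_mul,
    PiLp.single_apply, PiLp.neg_apply, Matrix.ofLp_toEuclideanCLM, Matrix.mulVec, dotProduct]
  simp only [mul_ite, mul_one, mul_zero, Finset.sum_ite_eq, Finset.mem_univ, if_true]
  rw [← Finset.sum_neg_distrib]
  refine Finset.sum_congr rfl fun a _ => ?_
  rw [hsym b a]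
  ring

variable [IsProbabilityMeasure Q]

/-- The characteristic function of the limit law `G^{-1/2} Z`. -/
theorem Regular.charFun_limit (h : Regular Θ f Q θ₀)
    {Ω' : Type*} [MeasurableSpace Ω'] {P' : Measure Ω'} {Z : Ω' → EuclideanSpace ℝ (Fin p)}
    (hZ : HasLaw Z (stdGaussian (EuclideanSpace ℝ (Fin p))) P') (t : EuclideanSpace ℝ (Fin p)) :
    charFun (P'.map fun ω =>
        Matrix.toEuclideanCLM (𝕜 := ℝ) (CFC.sqrt (godambe f Q θ₀)⁻¹) (Z ω)) t =
      Complex.exp (-(Var[fun y => ⟪Matrix.toEuclideanCLM (𝕜 := ℝ) (sensitivityMatrix f Q θ₀)⁻¹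
        (clusterScore f y θ₀), t⟫; Q] : ℝ) / 2) := by
  have hH : ((sensitivityMatrix f Q θ₀)⁻¹).conjTranspose = (sensitivityMatrix f Q θ₀)⁻¹ :=
    h.sensitivity_posDef.isHermitian.inv
  have hpsd : ((godambe f Q θ₀)⁻¹).PosSemidef := by
    have h1 := (posSemidef_covarianceMatrix h.variability_finite).conjTranspose_mul_mul_same
      (sensitivityMatrix f Q θ₀)⁻¹
    rw [hH] at h1
    rw [h.godambe_inv]
    exact h1
  -- A multivariate Gaussian is by definition the image of the standard one under the square root of
  -- its covariance.
  have hlaw : P'.map (fun ω =>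
      Matrix.toEuclideanCLM (𝕜 := ℝ) (CFC.sqrt (godambe f Q θ₀)⁻¹) (Z ω)) =
      multivariateGaussian 0 (godambe f Q θ₀)⁻¹ := by
    rw [multivariateGaussian, ← hZ.map_eq,
      AEMeasurable.map_map_of_aemeasurable (by fun_prop) hZ.aemeasurable]
    simp [Function.comp_def]
  rw [hlaw, charFun_multivariateGaussian hpsd, h.godambe_inv]
  simp_rw [h.inner_sensitivity_inv]
  rw [variance_inner_eq h.variability_finite, Matrix.ofLp_toEuclideanCLM]
  rw [inner_zero_right, Complex.ofReal_zero, zero_mul, zero_sub, neg_div]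
  congr 4
  have h2 : ∀ (N J : Matrix (Fin p) (Fin p) ℝ) (v : Fin p → ℝ), N.transpose = N →
      v ⬝ᵥ (N * J * N).mulVec v = N.mulVec v ⬝ᵥ J.mulVec (N.mulVec v) := by
    intro N J v hN
    rw [← Matrix.mulVec_mulVec, ← Matrix.mulVec_mulVec, Matrix.dotProduct_mulVec,
      ← Matrix.mulVec_transpose, hN]
  exact h2 _ _ _ (by simpa using hH)

end CompositeLikelihood

/-! ### Unbiasedness of the composite score -/

namespace CompositeLikelihood

variable {m p : ℕ} {𝓨 : Type*} [MeasurableSpace 𝓨] {ν : Measure 𝓨}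
  {Θ : Set (EuclideanSpace ℝ (Fin p))} {f : Fin m → 𝓨 → EuclideanSpace ℝ (Fin p) → ℝ}
  {Q : Measure (Fin m → 𝓨)} {θ₀ : EuclideanSpace ℝ (Fin p)} [IsProbabilityMeasure Q]

theorem Regular.integrable_clusterScore (h : Regular Θ f Q θ₀) :
    Integrable (fun y => clusterScore f y θ₀) Q :=
  (MemLp.of_eval_piLp h.variability_finite).integrable (by norm_num)

/-- The composite score has mean zero at the true value. -/
theorem integral_clusterScore_eq_zero (hmodel : CorrectlySpecified ν Θ f Q θ₀)
    (hreg : Regular Θ f Q θ₀) : ∫ y, clusterScore f y θ₀ ∂Q = 0 := by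
  obtain ⟨c, L, G, hc, hcΘ, hL, hL0, -, hGae, hGp⟩ := hreg.exists_smooth_set
  refine integral_eq_zero_of_inner_le (C := fun y => ‖hessianCLM (clusterLogLik f y) θ₀‖ + L y * c)
    hc hreg.integrable_clusterScore (hreg.integrable_hessianCLM.norm.add (hL.mul_const _))
    fun δ hδ => ?_
  -- Taylor bounds `⟪score, δ⟫` by the log-likelihood ratio plus a quadratic error, and `R`
  -- dominates that ratio.
  obtain ⟨R, hR, hR0, hle⟩ := hmodel.exists_logLik_sub_le hreg.common_support
    (hcΘ (show θ₀ + δ ∈ Metric.closedBall θ₀ c by simpa using hδ.le))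
  refine ⟨R, hR, hR0, ?_⟩
  filter_upwards [hle, hGae] with y hy hyG
  have h1 := abs_sub_sub_inner_gradient_le hc (hL0 y) (fun θ hθ => (hGp y hyG θ hθ).1)
    (fun θ hθ => (hGp y hyG θ hθ).2) hδ
  have h2 := neg_abs_le (clusterLogLik f y (θ₀ + δ) - clusterLogLik f y θ₀ -
    ⟪gradient (clusterLogLik f y) θ₀, δ⟫)
  rw [clusterScore]
  linarith

end CompositeLikelihood

/-! ### Assembly of the main theorem -/

theorem mainTheorem2 {m p : ℕ} {𝓨 : Type*} [MeasurableSpace 𝓨] (ν : Measure 𝓨)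
    (Θ : Set (EuclideanSpace ℝ (Fin p))) (f : Fin m → 𝓨 → EuclideanSpace ℝ (Fin p) → ℝ)
    (Q : Measure (Fin m → 𝓨)) (θ₀ : EuclideanSpace ℝ (Fin p))
    (hmodel : CorrectlySpecified ν Θ f Q θ₀) (hreg : Regular Θ f Q θ₀)
    -- the i.i.d. clusters, with common law `Q`
    {Ω : Type*} [MeasurableSpace Ω] (P : Measure Ω) [IsProbabilityMeasure P]
    (Y : ℕ → Ω → (Fin m → 𝓨)) (hlaw : ∀ i, HasLaw (Y i) Q P) (hindep : iIndepFun Y P)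
    -- a standard normal random vector
    {Ω' : Type*} [MeasurableSpace Ω'] (P' : Measure Ω') [IsProbabilityMeasure P']
    (Z : Ω' → EuclideanSpace ℝ (Fin p))
    (hZ : HasLaw Z (stdGaussian (EuclideanSpace ℝ (Fin p))) P') :
    -- an estimator: a measurable function of the first `n` clusters with values in `Θ`
    ∃ θhat : (n : ℕ) → (Fin n → Fin m → 𝓨) → EuclideanSpace ℝ (Fin p),
      (∀ n, Measurable (θhat n)) ∧ (∀ n y, θhat n y ∈ Θ) ∧
      -- with probability tending to one it solves the composite likelihood equation
      Tendsto (fun n : ℕ => P {ω | ¬ SolvesCompositeScore f (fun i : Fin n => Y i ω)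
        (θhat n fun i => Y i ω)}) atTop (𝓝 0) ∧
      -- `√n (θhat_n - θ₀) ⇒ G^{-1/2}(θ₀) Z`
      TendstoInDistribution
        (fun (n : ℕ) ω => √(n : ℝ) • (θhat n (fun i => Y i ω) - θ₀)) atTop
        (fun ω => Matrix.toEuclideanCLM (𝕜 := ℝ) (CFC.sqrt (godambe f Q θ₀)⁻¹) (Z ω))
        (fun _ => P) P' := by
  have hQ : IsProbabilityMeasure Q := by
    rw [← (hlaw 0).map_eq]
    exact Measure.isProbabilityMeasure_map (hlaw 0).aemeasurable
  obtain ⟨c, L, G, hc, hcΘ, hL, hL0, hG, hGae, hGp⟩ := hreg.exists_smooth_set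
  -- Halving the radius puts the closed working ball inside the open ball where third derivatives
  -- are controlled.
  have hr : 0 < c / 2 := by positivity
  have hrc : c / 2 < c := by linarith
  have hball : Metric.closedBall θ₀ (c / 2) ⊆ Metric.ball θ₀ c :=
    Metric.closedBall_subset_ball hrc
  have hself : θ₀ ∈ Metric.closedBall θ₀ (c / 2) := Metric.mem_closedBall_self hr.le
  -- the score, extended from the closed ball to the whole space
  let ψ : (Fin m → 𝓨) → EuclideanSpace ℝ (Fin p) → EuclideanSpace ℝ (Fin p) := fun y θ =>
    G.indicator (fun y => gradient (clusterLogLik f y) (radialRetraction θ₀ (c / 2) θ)) y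
  have hψeq : ∀ y ∈ G, ∀ θ ∈ Metric.closedBall θ₀ (c / 2),
      ψ y θ = gradient (clusterLogLik f y) θ := fun y hy θ hθ => by
    simp only [ψ, hy, Set.indicator_of_mem, radialRetraction_eq_self hr hθ]
  have hψm : ∀ θ, Measurable fun y => ψ y θ := fun θ =>
    measurable_indicator_gradient hG
      (mem_of_superset (Metric.isOpen_ball.mem_nhds (hball (radialRetraction_mem θ₀ hr θ)))
        (Metric.ball_subset_closedBall.trans hcΘ))
      (fun θ hθ => hmodel.measurable_clusterLogLik hθ)
      fun y hy => (hGp y hy _ (hball (radialRetraction_mem θ₀ hr θ))).1.differentiableAt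
        (by norm_num)
  have hψc : ∀ y, Continuous (ψ y) := by
    intro y
    by_cases hy : y ∈ G
    · have h1 : ψ y = fun θ => gradient (clusterLogLik f y) (radialRetraction θ₀ (c / 2) θ) := by
        funext θ
        simp only [ψ, hy, Set.indicator_of_mem]
      rw [h1, continuous_iff_continuousAt]
      intro θ
      exact ContinuousAt.comp (f := radialRetraction θ₀ (c / 2))
        (contDiffAt_gradient (hGp y hy _ (hball (radialRetraction_mem θ₀ hr θ))).1).continuousAt
        (continuous_radialRetraction θ₀ hr).continuousAt
    · have h1 : ψ y = fun _ => 0 := by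
        funext θ
        simp only [ψ, hy, not_false_eq_true, Set.indicator_of_notMem]
      rw [h1]
      exact continuous_const
  have hψae : (fun y => ψ y θ₀) =ᵐ[Q] fun y => clusterScore f y θ₀ := by
    filter_upwards [hGae] with y hy
    exact hψeq y hy θ₀ hself
  have hψint : Integrable (fun y => ψ y θ₀) Q := hreg.integrable_clusterScore.congr hψae.symm
  have hψ0 : ∫ y, ψ y θ₀ ∂Q = 0 :=
    (integral_congr_ae hψae).trans (integral_clusterScore_eq_zero hmodel hreg)
  have hψL2 : MemLp (fun y => ψ y θ₀) 2 Q :=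
    (MemLp.of_eval_piLp hreg.variability_finite).ae_eq hψae.symm
  have hψexp : ∀ᵐ y ∂Q, ∀ ρ ≤ c / 2, ∀ θ ∈ Metric.closedBall θ₀ ρ,
      ∀ θ' ∈ Metric.closedBall θ₀ ρ,
      ‖ψ y θ - ψ y θ' - hessianCLM (clusterLogLik f y) θ₀ (θ - θ')‖ ≤ L y * ρ * ‖θ - θ'‖ := by
    filter_upwards [hGae] with y hy ρ hρ θ hθ θ' hθ'
    rw [hψeq y hy θ (Metric.closedBall_subset_closedBall hρ hθ),
      hψeq y hy θ' (Metric.closedBall_subset_closedBall hρ hθ')]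
    exact norm_gradient_sub_sub_hessianCLM_le hc (hL0 y) (fun θ hθ => (hGp y hy θ hθ).1)
      (fun θ hθ => (hGp y hy θ hθ).2) (hρ.trans_lt hrc) hθ hθ'
  -- The mean Hessian is `-H`, so the Newton preconditioner is `H⁻¹`.
  set B := Matrix.toEuclideanCLM (𝕜 := ℝ) (sensitivityMatrix f Q θ₀)⁻¹ with hBdef
  have hdet : IsUnit (sensitivityMatrix f Q θ₀).det :=
    (Matrix.isUnit_iff_isUnit_det _).1 hreg.sensitivity_posDef.isUnit
  have hBH : B * Matrix.toEuclideanCLM (𝕜 := ℝ) (sensitivityMatrix f Q θ₀) = 1 := by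
    rw [hBdef, ← map_mul, Matrix.nonsing_inv_mul _ hdet, map_one]
  have hHB : Matrix.toEuclideanCLM (𝕜 := ℝ) (sensitivityMatrix f Q θ₀) * B = 1 := by
    rw [hBdef, ← map_mul, Matrix.mul_nonsing_inv _ hdet, map_one]
  have hB : ∀ v, B ((∫ y, hessianCLM (clusterLogLik f y) θ₀ ∂Q) v) = -v := by
    intro v
    rw [hreg.integral_hessianCLM, neg_apply, map_neg]
    exact congrArg Neg.neg (congrArg (fun T => T v) hBH)
  have hBinj : Function.Injective B :=
    Function.LeftInverse.injective
      (g := Matrix.toEuclideanCLM (𝕜 := ℝ) (sensitivityMatrix f Q θ₀)) fun v => congrArg (fun T => T v) hHB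
  -- the central limit theorem for the score
  have hψBm : Measurable fun y => B (ψ y θ₀) := B.measurable.comp (hψm θ₀)
  have hident : ∀ i, IdentDistrib (fun ω => B (ψ (Y i ω) θ₀)) (fun ω => B (ψ (Y 0 ω) θ₀)) P P :=
    fun i => (IdentDistrib.mk (hlaw i).aemeasurable (hlaw 0).aemeasurable
      ((hlaw i).map_eq.trans (hlaw 0).map_eq.symm)).comp hψBm
  have hBL2 : MemLp (fun ω => B (ψ (Y 0 ω) θ₀)) 2 P := by
    have h1 : MemLp (fun y => B (ψ y θ₀)) 2 (P.map (Y 0)) := by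
      rw [(hlaw 0).map_eq]
      exact B.comp_memLp' hψL2
    exact (memLp_map_measure_iff h1.aestronglyMeasurable (hlaw 0).aemeasurable).1 h1
  have hB0 : ∫ ω, B (ψ (Y 0 ω) θ₀) ∂P = 0 := by
    have h1 := (hlaw 0).integral_comp (f := fun y => B (ψ y θ₀)) hψBm.aestronglyMeasurable
    rw [Function.comp_def] at h1
    rw [h1, B.integral_comp_comm hψint, hψ0, map_zero]
  have hclt := tendstoInDistribution_sqrt_smul_average
    (X := fun i ω => B (ψ (Y i ω) θ₀)) (P := P) (P' := P')
    (W := fun ω => Matrix.toEuclideanCLM (𝕜 := ℝ) (CFC.sqrt (godambe f Q θ₀)⁻¹) (Z ω))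
    hBL2 hB0 (hindep.comp (fun _ y => B (ψ y θ₀)) fun _ => hψBm) hident
    ((ContinuousLinearMap.measurable _).comp_aemeasurable hZ.aemeasurable) (fun t => by
      rw [hreg.charFun_limit hZ t]
      have h1 : Var[fun ω => ⟪B (ψ (Y 0 ω) θ₀), t⟫; P] = Var[fun y => ⟪B (ψ y θ₀), t⟫; Q] := by
        rw [← (hlaw 0).map_eq, variance_map (by fun_prop) (hlaw 0).aemeasurable]
        rfl
      have h2 : Var[fun y => ⟪B (ψ y θ₀), t⟫; Q] = Var[fun y => ⟪B (clusterScore f y θ₀), t⟫; Q] :=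
        variance_congr (by filter_upwards [hψae] with y hy; rw [hy])
      rw [h1, h2])
  obtain ⟨θhat, hm, hmem, hsol, hdist⟩ := exists_root_tendstoInDistribution hr hψm hψc hψint hψ0
    hreg.integrable_hessianCLM hL hψexp hBinj hB hlaw hindep (P' := P')
    (W := fun ω => Matrix.toEuclideanCLM (𝕜 := ℝ) (CFC.sqrt (godambe f Q θ₀)⁻¹) (Z ω))
    (by simpa only [map_smul, map_sum] using hclt)
  refine ⟨θhat, hm, fun n y => hcΘ (Metric.ball_subset_closedBall (hball (hmem n y))), ?_, hdist⟩
  refine tendsto_of_tendsto_of_tendsto_of_le_of_le tendsto_const_nhds hsol (fun _ => zero_le)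
    fun n => measure_mono_ae ?_
  -- Almost surely every cluster lies in `G`, where `ψ` on the ball is the true score, so a zero of
  -- `∑ ψ` solves the likelihood equation.
  have hYG : ∀ᵐ ω ∂P, ∀ i, Y i ω ∈ G := ae_all_iff.2 fun i =>
    ae_of_ae_map (hlaw i).aemeasurable (by rw [(hlaw i).map_eq]; exact hGae)
  filter_upwards [hYG] with ω hω hnot hzero
  refine hnot ?_
  have hτ := hmem n fun i => Y i ω
  set τ := θhat n fun i => Y i ω
  have hgrad : ∀ i : Fin n, HasFDerivAt (clusterLogLik f (Y i ω))
      (fderiv ℝ (clusterLogLik f (Y i ω)) τ) τ := fun i =>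
    ((hGp _ (hω i) τ (hball hτ)).1.differentiableAt (by norm_num)).hasFDerivAt
  rw [SolvesCompositeScore, hasGradientAt_iff_hasFDerivAt]
  have hsum := HasFDerivAt.fun_sum (u := Finset.univ) fun i _ => hgrad i
  refine hsum.congr_fderiv ?_
  rw [← hzero, map_sum]
  refine Finset.sum_congr rfl fun i _ => ?_
  rw [hψeq _ (hω i) τ hτ, gradient, LinearIsometryEquiv.apply_symm_apply]
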